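/- **Setting.** Let $\partial$ be a cemetery state. A *cell process* is a time-homogeneous Feller process $X=(X(t),t\ge 0)$ on $(0,\infty)\cup\{\partial\}$, absorbed at $\partial$, with càdlàg paths without positive jumps; $P_x$ is its law started from $x>0$ and $E_x$ the expectation. While $X$ is alive, $-\Delta X(r)=X(r-)-X(r)\ge 0$; a jump time is a time $r$ at which $X$ is alive and $-\Delta X(r)>0$ (so the passage to $\partial$ is not counted). **Hypothesis [H].** There is a measurable $f:[0,\infty)\times((0,\infty)\cup\{\partial\})\to[0,\infty)$ with $f(r,\partial)=0$ for all $r\geq 0$ and $\inf_{r<l,\,x>a}f(r,x)>0$ for all $a,l>0$, such that for all $x>0$ and $s,t\ge 0$ $$E_x\Big[f(s+t,X(t))+\sum_{0\le r\le t}f(s+r,-\Delta X(r))\Big]\le f(s,x),$$ the sum being over the jump times $r$ of $X$ in $[0,t]$. **Growth-fragmentation.** Fix such an $f$. List the jump times $t_0,t_1,\dots$ of a path of $X$ so that $f(t_i,-\Delta X(t_i))$ is decreasing, ties being listed in the order of time; put $t_i=\infty$ if there are too few jumps. (By [H] this lists all jump times, $P_x$-almost surely.) Let $\mathcal U=\bigcup_{n\ge0}\mathbb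 N^n$, where $\mathbb N=\{0,1,\dots\}$. For $x>0$ let $\mathcal P_x$ be the law of the cell system $(\mathcal X_u,u\in\mathcal U)$ built as follows. The ancestor $\mathcal X_\emptyset$ has law $P_x$ and birth time $b_\emptyset=0$. Given the generations up to $n$, the cells of generation $n+1$ are independent; for $|u|=n$, if $t_i$ is the $i$-th jump time of $\mathcal X_u$ and $t_i<\infty$, then $\mathcal X_{ui}$ has law $P_{-\Delta\mathcal X_u(t_i)}$ and birth time $b_{ui}=b_u+t_i$, and if $t_i=\infty$, then $\mathcal X_{ui}\equiv\partial$ and $b_{ui}=\infty$. The growth-fragmentation is the multiset-valued process $$\mathbf X(t)=\{\!\{\mathcal X_u(t-b_u):u\in\mathcal U,\ b_u\le t,\ \mathcal X_u(t-b_u)\ne\partial\}\!\},\qquad t\ge0.$$ Multisets $J$ on $(0,\infty)$ are identified with the point measures $\sum_{y\in J}\delta_y$, with the $\sigma$-algebra generated by $J\mapsto |J\cap A|$, $A$ Borel. Let $\mathcal M_f^s$ be the set of the multisets $J$ on $(0,\infty)$ with $\sum_{y\in J}f(s,y)<\infty$. For $t\ge s\geq 0$ and $J\in\mathcal M_f^s$,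 let $\rho_{s,t}(J,\cdot)$ be the law of $\biguplus_{y\in J}\mathbf X_y$, where the $\mathbf X_y$, $y\in J$, are independent and $\mathbf X_y$ has the law of $\mathbf X(t-s)$ under $\mathcal P_y$. **Proposition (temporal branching property).** Suppose that [H] holds for $X$ with $f$. Then for all $t\ge s\ge 0$, $\rho_{s,t}$ is a well-defined probability kernel from $\mathcal M_f^s$ to $\mathcal M_f^t$, and for every $x>0$, under $\mathcal P_x$, almost surely $\mathbf X(s)\in\mathcal M_f^s$, each $\mathbf X(r)$ $(r\geq 0)$ is measurable, and the conditional distribution of $\mathbf X(t)$ given $(\mathbf X(r),0\le r\le s)$ is $\rho_{s,t}(\mathbf X(s),\cdot)$; that is, for every measurable set $B$ of multisets, $$\mathcal P_x\big(\mathbf X(t)\in B\,\big|\,\sigma(\mathbf X(r),0\le r\le s)\big)=\rho_{s,t}(\mathbf X(s),B)\quad\mathcal P_x\text{-a.s.}$$ -/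

import Mathlib

open MeasureTheory ProbabilityTheory Filter Topology
open scoped NNReal ENNReal ZeroAtInfty

namespace GrowthFrag

/-- The path of a cell with values in `(0, ∞) ∪ {∂}`. The state `∂` is encoded by the number `0`,
which is not a size; the clock starts at time `0`. `∂` is a cemetery; the path is right-continuous;
at a time `t` at which the cell is alive it has a left limit in `(0, ∞)` that is at least the value
at `t` (no positive jump); and at its death it may be killed by a jump or leave every compact subset
of `(0, ∞)` (left limit `0` or `∞`), so that it is càdlàg in `(0, ∞)` compactified by `∂`. -/
structure IsCellPath (w : ℝ≥0 → ℝ≥0) : Prop where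
  absorbed : ∀ ⦃r t : ℝ≥0⦄, r ≤ t → w r = 0 → w t = 0
  right_cont : ∀ t, Tendsto w (𝓝[>] t) (𝓝 (w t))
  left_lim : ∀ t, ∃ l : ℝ≥0∞, Tendsto (fun r => (w r : ℝ≥0∞)) (𝓝[<] t) (𝓝 l)
  no_pos_jump : ∀ t, w t ≠ 0 → ∃ l : ℝ≥0, Tendsto w (𝓝[<] t) (𝓝 l) ∧ w t ≤ l

/-- The space of cell paths; as a subtype of a product it carries the σ-algebra generated by the
evaluations. -/
abbrev CellPath : Type := {w : ℝ≥0 → ℝ≥0 // IsCellPath w}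

theorem isCellPath_shift {w : ℝ≥0 → ℝ≥0} (hw : IsCellPath w) (s : ℝ≥0) :
    IsCellPath (fun r => w (s + r)) := by
  have hR : ∀ t, Tendsto (fun r => s + r) (𝓝[>] t) (𝓝[>] (s + t)) := fun t => by
    refine tendsto_nhdsWithin_iff.2 ⟨?_, ?_⟩
    · exact ((continuous_const.add continuous_id).tendsto t).mono_left nhdsWithin_le_nhds
    · filter_upwards [self_mem_nhdsWithin] with r hr
      exact add_lt_add_right (Set.mem_Ioi.1 hr) s
  have hL : ∀ t, Tendsto (fun r => s + r) (𝓝[<] t) (𝓝[<] (s + t)) := fun t => by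
    refine tendsto_nhdsWithin_iff.2 ⟨?_, ?_⟩
    · exact ((continuous_const.add continuous_id).tendsto t).mono_left nhdsWithin_le_nhds
    · filter_upwards [self_mem_nhdsWithin] with r hr
      exact add_lt_add_right (Set.mem_Iio.1 hr) s
  refine ⟨fun r t hrt h => hw.absorbed (add_le_add_right hrt s) h, fun t => ?_, fun t => ?_,
    fun t ht => ?_⟩
  · exact (hw.right_cont (s + t)).comp (hR t)
  · obtain ⟨l, hl⟩ := hw.left_lim (s + t)
    exact ⟨l, hl.comp (hL t)⟩
  · obtain ⟨l, hl, h⟩ := hw.no_pos_jump (s + t) ht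
    exact ⟨l, hl.comp (hL t), h⟩

/-- The path after time `s`. -/
def shift (s : ℝ≥0) (w : CellPath) : CellPath := ⟨fun r => w.1 (s + r), isCellPath_shift w.2 s⟩

/-- The size `-ΔX(r) = X(r-) - X(r)` of the jump at time `r`. It is `0`, that is `∂`, if there is no
jump at time `r` (in particular at `r = 0`) or if the cell is dead at time `r`: the passage to `∂`
is not a jump and produces no daughter. -/
noncomputable def jumpSize (w : CellPath) (r : ℝ≥0) : ℝ≥0 :=
  if w.1 r = 0 then 0 else Function.leftLim w.1 r - w.1 r

/-- The jump time `r'` comes before `r` when the jump times are listed with `f(r, -ΔX(r))`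
decreasing, ties being listed in the order of time. -/
def Precedes (f : ℝ≥0 → ℝ≥0 → ℝ≥0) (w : CellPath) (r' r : ℝ≥0) : Prop :=
  jumpSize w r' ≠ 0 ∧ (f r (jumpSize w r) < f r' (jumpSize w r') ∨
    (f r' (jumpSize w r') = f r (jumpSize w r) ∧ r' < r))

/-- `r` is the jump time preceded by exactly `i` others (`i = 0, 1, 2, …`). -/
def IsJumpOfRank (f : ℝ≥0 → ℝ≥0 → ℝ≥0) (w : CellPath) (i : ℕ) (r : ℝ≥0) : Prop :=
  jumpSize w r ≠ 0 ∧ {r' | Precedes f w r' r}.encard = i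

/-- The `i`-th jump time in the list; it is `∞` if there is none. -/
noncomputable def jumpTime (f : ℝ≥0 → ℝ≥0 → ℝ≥0) (i : ℕ) (w : CellPath) : ℝ≥0∞ :=
  ⨅ (r : ℝ≥0) (_ : IsJumpOfRank f w i r), (r : ℝ≥0∞)

/-- The size at birth of the `i`-th daughter; it is `∂` if there is none. -/
noncomputable def childSize (f : ℝ≥0 → ℝ≥0 → ℝ≥0) (i : ℕ) (w : CellPath) : ℝ≥0 :=
  if jumpTime f i w = ⊤ then 0 else jumpSize w (jumpTime f i w).toNNReal

theorem measurable_eval : Measurable fun p : CellPath × ℝ≥0 => p.1.1 p.2 := by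
  have h1 : ∀ n : ℕ, Measurable fun p : CellPath × ℝ≥0 =>
      p.1.1 (((⌊((n : ℝ≥0) + 1) * p.2⌋₊ : ℝ≥0) + 1) / ((n : ℝ≥0) + 1)) := fun n => by
    have h : Measurable fun q : CellPath × ℕ => q.1.1 (((q.2 : ℝ≥0) + 1) / ((n : ℝ≥0) + 1)) :=
      measurable_from_prod_countable_left fun k =>
        (measurable_pi_apply (((k : ℝ≥0) + 1) / ((n : ℝ≥0) + 1))).comp measurable_subtype_coe
    exact h.comp (measurable_fst.prodMk
      (Nat.measurable_floor.comp (measurable_const.mul measurable_snd)))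
  refine measurable_of_tendsto_metrizable h1 (tendsto_pi_nhds.2 fun p => ?_)
  refine (p.1.2.right_cont p.2).comp (tendsto_nhdsWithin_iff.2 ⟨?_, .of_forall fun n => ?_⟩)
  · have hup : Tendsto (fun n : ℕ => p.2 + 1 / ((n : ℝ≥0) + 1)) atTop (𝓝 p.2) := by
      simpa using (tendsto_const_nhds (x := p.2)).add
        (tendsto_one_div_add_atTop_nhds_zero_nat (𝕜 := ℝ≥0))
    refine tendsto_of_tendsto_of_tendsto_of_le_of_le tendsto_const_nhds hup (fun n => ?_)
      (fun n => ?_)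
    · have hn : (0 : ℝ≥0) < (n : ℝ≥0) + 1 := by positivity
      simp only
      rw [le_div_iff₀ hn, mul_comm]
      exact (Nat.lt_floor_add_one _).le
    · have hn : (0 : ℝ≥0) < (n : ℝ≥0) + 1 := by positivity
      simp only
      rw [div_le_iff₀ hn, add_mul p.2, div_mul_cancel₀ _ hn.ne', mul_comm p.2]
      exact add_le_add_left (Nat.floor_le zero_le) 1
  · have hn : (0 : ℝ≥0) < (n : ℝ≥0) + 1 := by positivity
    simp only [Set.mem_Ioi]
    rw [lt_div_iff₀ hn, mul_comm]
    exact Nat.lt_floor_add_one _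

theorem neBot_left {r : ℝ≥0} (h : r ≠ 0) : (𝓝[<] r).NeBot :=
  nhdsLT_neBot_of_exists_lt ⟨0, pos_iff_ne_zero.2 h⟩

theorem left_eq_bot : 𝓝[<] (0 : ℝ≥0) = ⊥ := by
  have : Set.Iio (0 : ℝ≥0) = ∅ := by ext; simp
  rw [this, nhdsWithin_empty]

theorem jumpSize_zero (w : CellPath) : jumpSize w 0 = 0 := by
  rw [jumpSize, leftLim_eq_of_eq_bot _ left_eq_bot]; simp

theorem jumpSize_eq {w : CellPath} {r l : ℝ≥0} (hr : r ≠ 0) (h : w.1 r ≠ 0)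
    (hl : Tendsto w.1 (𝓝[<] r) (𝓝 l)) : jumpSize w r = l - w.1 r := by
  have := neBot_left hr
  rw [jumpSize, if_neg h, leftLim_eq_of_tendsto hl]

theorem measurable_jumpSize : Measurable fun p : CellPath × ℝ≥0 => jumpSize p.1 p.2 := by
  have h1 : ∀ n : ℕ, Measurable fun p : CellPath × ℝ≥0 =>
      if p.1.1 p.2 = 0 then 0 else p.1.1 (p.2 - 1 / ((n : ℝ≥0) + 1)) - p.1.1 p.2 := fun n => by
    refine Measurable.ite (measurable_eval (measurableSet_singleton 0)) measurable_const ?_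
    exact (measurable_eval.comp (measurable_fst.prodMk (measurable_snd.sub_const _))).sub
      measurable_eval
  refine measurable_of_tendsto_metrizable h1 (tendsto_pi_nhds.2 fun p => ?_)
  obtain ⟨w, r⟩ := p
  by_cases h : w.1 r = 0
  · simp [h, jumpSize]
  by_cases hr : r = 0
  · subst hr; simp [jumpSize_zero]
  obtain ⟨l, hl, -⟩ := w.2.no_pos_jump r h
  simp only [if_neg h, jumpSize_eq hr h hl]
  refine Tendsto.sub ?_ tendsto_const_nhds
  refine hl.comp (tendsto_nhdsWithin_iff.2 ⟨?_, .of_forall fun n => ?_⟩)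
  · simpa using (tendsto_const_nhds (x := r)).sub
        (tendsto_one_div_add_atTop_nhds_zero_nat (𝕜 := ℝ≥0))
  · exact tsub_lt_self (pos_iff_ne_zero.2 hr) (by positivity)

theorem exists_nnrat_btwn {a b : ℝ≥0} (h : a < b) : ∃ q : ℚ≥0, a < (q : ℝ≥0) ∧ (q : ℝ≥0) < b := by
  obtain ⟨q, hq1, hq2⟩ := exists_rat_btwn (NNReal.coe_lt_coe.2 h)
  have hq : 0 ≤ q := by exact_mod_cast (a.2.trans hq1.le)
  lift q to ℚ≥0 using hq
  exact ⟨q, by exact_mod_cast hq1, by exact_mod_cast hq2⟩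

/-- Detection of a jump larger than `c` in `(a, b)` through the values at rational times. -/
theorem exists_jump_iff (w : CellPath) (a b c : ℝ≥0) :
    (∃ r, a < r ∧ r < b ∧ c < jumpSize w r) ↔
    ∃ (m : ℕ) (b' : ℚ≥0), (b' : ℝ≥0) < b ∧ w.1 b' ≠ 0 ∧ ∀ n : ℕ, ∃ p q : ℚ≥0,
      a < (p : ℝ≥0) ∧ (p : ℝ≥0) < q ∧ (q : ℝ≥0) < b' ∧ (q : ℝ≥0) < p + 1 / ((n : ℝ≥0) + 1) ∧
      w.1 q + (c + 1 / ((m : ℝ≥0) + 1)) < w.1 p := by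
  constructor
  · rintro ⟨r, har, hrb, hc⟩
    have h : w.1 r ≠ 0 := fun h => by simp [jumpSize, h] at hc
    have hr : r ≠ 0 := (pos_of_gt har).ne'
    have := neBot_left hr
    obtain ⟨l, hl, -⟩ := w.2.no_pos_jump r h
    rw [jumpSize_eq hr h hl] at hc
    obtain ⟨m, hm⟩ := exists_nat_one_div_lt (tsub_pos_of_lt hc)
    have hm : w.1 r + (c + 1 / ((m : ℝ≥0) + 1)) < l := by
      have := lt_tsub_iff_left.1 hm
      exact lt_tsub_iff_left.1 this
    have hq : Tendsto (fun q => w.1 q + (c + 1 / ((m : ℝ≥0) + 1))) (𝓝[>] r)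
        (𝓝 (w.1 r + (c + 1 / ((m : ℝ≥0) + 1)))) := (w.2.right_cont r).add tendsto_const_nhds
    obtain ⟨z, hz1, hz2⟩ := exists_between hm
    have hev1 := hq.eventually_lt_const hz1
    have hev2 := hl.eventually_const_lt hz2
    have hev3 := (w.2.right_cont r).eventually_ne h
    obtain ⟨u, hu, hu'⟩ := (mem_nhdsGT_iff_exists_Ioo_subset' hrb).1
      (inter_mem (inter_mem hev1 hev3) (Ioo_mem_nhdsGT hrb))
    obtain ⟨v, hv, hv'⟩ := (mem_nhdsLT_iff_exists_Ioo_subset' har).1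
      (inter_mem hev2 (Ioo_mem_nhdsLT har))
    obtain ⟨b', hb1, hb2⟩ := exists_nnrat_btwn hu
    refine ⟨m, b', (hu' ⟨hb1, hb2⟩).2.2, (hu' ⟨hb1, hb2⟩).1.2, fun n => ?_⟩
    have hn : (0 : ℝ≥0) < 1 / ((n : ℝ≥0) + 1) / 2 := by positivity
    obtain ⟨p, hp1, hp2⟩ := exists_nnrat_btwn
      (max_lt hv (tsub_lt_self (pos_iff_ne_zero.2 hr) hn))
    obtain ⟨q, hq1, hq2⟩ := exists_nnrat_btwn
      (lt_min hb1 (lt_add_of_pos_right r hn))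
    have hqq := lt_min_iff.1 hq2
    have hpp := max_lt_iff.1 hp1
    refine ⟨p, q, (hv' ⟨hpp.1, hp2⟩).2.1, hp2.trans hq1, hqq.1, ?_,
      ((hu' ⟨hq1, hqq.1.trans hb2⟩).1.1).trans (hv' ⟨hpp.1, hp2⟩).1⟩
    refine hqq.2.trans ?_
    have h3 : r < p + 1 / ((n : ℝ≥0) + 1) / 2 := lt_add_of_tsub_lt_right hpp.2
    calc r + 1 / ((n : ℝ≥0) + 1) / 2
        < p + 1 / ((n : ℝ≥0) + 1) / 2 + 1 / ((n : ℝ≥0) + 1) / 2 := by gcongr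
      _ = _ := by rw [add_assoc, add_halves]
  · rintro ⟨m, b', hb', hb0, hmesh⟩
    by_contra! hno
    set e : ℝ≥0 := 1 / ((m : ℝ≥0) + 1) with he
    have he0 : 0 < e := by positivity
    have key : ∀ r ∈ Set.Icc a (b' : ℝ≥0), ∃ V, IsOpen V ∧ r ∈ V ∧ ∀ p ∈ V, ∀ q ∈ V,
        a < p → p < q → w.1 p ≤ w.1 q + (c + e) := by
      rintro r ⟨har, hrb⟩
      have h : w.1 r ≠ 0 := fun h => hb0 (w.2.absorbed hrb h)
      obtain ⟨l, hl, hle⟩ := w.2.no_pos_jump r h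
      have hlc : a < r → l ≤ w.1 r + c := fun har' => by
        have := hno r har' (hrb.trans_lt hb')
        rw [jumpSize_eq (pos_of_gt har').ne' h hl] at this
        exact tsub_le_iff_left.1 this
      have e2 : 0 < e / 2 := by positivity
      have hR : ∀ᶠ q in 𝓝[>] r, dist (w.1 q) (w.1 r) < e / 2 :=
        (w.2.right_cont r).eventually (Metric.ball_mem_nhds _ (by exact_mod_cast e2))
      have hL : ∀ᶠ q in 𝓝[<] r, dist (w.1 q) l < e / 2 :=
        hl.eventually (Metric.ball_mem_nhds _ (by exact_mod_cast e2))
      rw [eventually_nhdsWithin_iff] at hR hL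
      obtain ⟨V, hV, hVo, hrV⟩ := mem_nhds_iff.1 (inter_mem hR hL)
      refine ⟨V, hVo, hrV, fun p hp q hq hap hpq => ?_⟩
      have hp := hV hp
      have hq := hV hq
      simp only [Set.mem_inter_iff, Set.mem_ofPred_eq, Set.mem_Ioi, Set.mem_Iio, NNReal.dist_eq,
        abs_lt] at hp hq
      have hc0 : (0 : ℝ) ≤ c := c.2
      have he0' : (0 : ℝ) < e := he0
      rw [← NNReal.coe_le_coe]
      push_cast
      rcases lt_trichotomy p r with hpr | hpr | hpr
      · have h1 := hp.2 hpr
        have h2 : (l : ℝ) ≤ w.1 r + c := by exact_mod_cast hlc (hap.trans hpr)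
        rcases lt_trichotomy q r with hqr | hqr | hqr
        · have := hq.2 hqr
          linarith [h1.1, h1.2, this.1, this.2]
        · subst hqr
          linarith [h1.1, h1.2]
        · have := hq.1 hqr
          linarith [h1.1, h1.2, this.1, this.2]
      · subst hpr
        have := hq.1 hpq
        linarith [this.1, this.2]
      · have h1 := hp.1 hpr
        have := hq.1 (hpr.trans hpq)
        linarith [h1.1, h1.2, this.1, this.2]
    choose! V hVo hrV hV using key
    obtain ⟨δ, hδ, hball⟩ := lebesgue_number_lemma_of_metric (s := Set.Icc a (b' : ℝ≥0))
      (c := fun r : Set.Icc a (b' : ℝ≥0) => V r) isCompact_Icc (fun r => hVo r r.2)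
      (fun r hr => Set.mem_iUnion.2 ⟨⟨r, hr⟩, hrV r hr⟩)
    obtain ⟨n, hn⟩ := exists_nat_one_div_lt hδ
    obtain ⟨p, q, hap, hpq, hqb, hqp, hlt⟩ := hmesh n
    obtain ⟨r, hr⟩ := hball p ⟨hap.le, (hpq.trans hqb).le⟩
    refine absurd hlt (not_lt.2 (hV r r.2 p (hr (Metric.mem_ball_self hδ)) q (hr ?_) hap hpq))
    rw [Metric.mem_ball, NNReal.dist_eq, abs_lt]
    have h1 : ((p : ℝ≥0) : ℝ) < (q : ℝ≥0) := by exact_mod_cast hpq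
    have h2 : ((q : ℝ≥0) : ℝ) < (p : ℝ≥0) + 1 / ((n : ℝ) + 1) := by exact_mod_cast hqp
    constructor <;> linarith

/-- The first time in `(a, b)` at which a path makes a jump larger than `c` -/
noncomputable def firstJump (a b c : ℝ≥0) (w : CellPath) : ℝ≥0∞ :=
  ⨅ (r : ℝ≥0) (_ : a < r ∧ r < b ∧ c < jumpSize w r), (r : ℝ≥0∞)

theorem measurableSet_exists_jump (a b c : ℝ≥0) :
    MeasurableSet {w : CellPath | ∃ r, a < r ∧ r < b ∧ c < jumpSize w r} := by
  have hev : ∀ r : ℝ≥0, Measurable fun w : CellPath => w.1 r := fun r =>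
    (measurable_pi_apply r).comp measurable_subtype_coe
  simp only [exists_jump_iff]
  simp only [Set.ofPred_exists, Set.ofPred_and, Set.ofPred_forall]
  refine .iUnion fun m => .iUnion fun b' => .inter (.const _) (.inter ?_ (.iInter fun n =>
    .iUnion fun p => .iUnion fun q => .inter (.const _) (.inter (.const _) (.inter (.const _)
    (.inter (.const _) ?_)))))
  · exact (hev b' (measurableSet_singleton 0)).compl
  · exact measurableSet_lt ((hev q).add_const _) (hev p)

theorem measurable_firstJump (a b c : ℝ≥0) : Measurable (firstJump a b c) := by
  refine measurable_of_Iio fun z => ?_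
  have : firstJump a b c ⁻¹' Set.Iio z = {w | ∃ r, a < r ∧ r < b ∧ c < jumpSize w r ∧
      (r : ℝ≥0∞) < z} := by
    ext w
    simp only [firstJump, Set.mem_preimage, Set.mem_Iio, iInf_lt_iff, Set.mem_ofPred_eq]
    constructor
    · rintro ⟨r, ⟨h1, h2, h3⟩, h4⟩
      exact ⟨r, h1, h2, h3, h4⟩
    · rintro ⟨r, h1, h2, h3, h4⟩
      exact ⟨r, ⟨h1, h2, h3⟩, h4⟩
  rw [this]
  induction z with
  | top => simpa using measurableSet_exists_jump a b c
  | coe z =>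
    convert measurableSet_exists_jump a (min b z) c using 5 with w r
    simp only [lt_min_iff, ENNReal.coe_lt_coe]
    tauto

/-- Every jump time is one of countably many first jump times. -/
theorem exists_firstJump_eq (w : CellPath) {r : ℝ≥0} (hj : jumpSize w r ≠ 0) :
    ∃ a b c : ℚ≥0, (firstJump a b c w).toNNReal = r := by
  have h : w.1 r ≠ 0 := fun h => hj (by simp [jumpSize, h])
  have hr : r ≠ 0 := fun h => hj (by rw [h, jumpSize_zero])
  have hr' := pos_iff_ne_zero.2 hr
  have := neBot_left hr
  obtain ⟨l, hl, hle⟩ := w.2.no_pos_jump r h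
  obtain ⟨c, hc0, hc⟩ := exists_nnrat_btwn (pos_iff_ne_zero.2 hj)
  have e2 : (0 : ℝ≥0) < c / 2 := by positivity
  have hR : ∀ᶠ q in 𝓝[>] r, dist (w.1 q) (w.1 r) < (c : ℝ≥0) / 2 ∧ w.1 q ≠ 0 :=
    ((w.2.right_cont r).eventually (Metric.ball_mem_nhds _ (by exact_mod_cast e2))).and
      ((w.2.right_cont r).eventually_ne h)
  have hL : ∀ᶠ q in 𝓝[<] r, dist (w.1 q) l < (c : ℝ≥0) / 2 :=
    hl.eventually (Metric.ball_mem_nhds _ (by exact_mod_cast e2))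
  obtain ⟨u, hu, hu'⟩ := (mem_nhdsGT_iff_exists_Ioo_subset' (lt_add_one r)).1 hR
  obtain ⟨v, hv, hv'⟩ := (mem_nhdsLT_iff_exists_Ioo_subset' hr').1 hL
  obtain ⟨a, ha1, ha2⟩ := exists_nnrat_btwn (Set.mem_Iio.1 hv)
  obtain ⟨b, hb1, hb2⟩ := exists_nnrat_btwn (Set.mem_Ioi.1 hu)
  refine ⟨a, b, c, ?_⟩
  have huniq : ∀ r', (a : ℝ≥0) < r' → r' < b → (c : ℝ≥0) < jumpSize w r' → r' = r := by
    intro r' h1 h2 h3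
    by_contra hne
    have h0 : w.1 r' ≠ 0 := fun h => by simp [jumpSize, h] at h3
    have hr0 : r' ≠ 0 := (pos_of_gt h1).ne'
    have := neBot_left hr0
    obtain ⟨l', hl', hle'⟩ := w.2.no_pos_jump r' h0
    rw [jumpSize_eq hr0 h0 hl', lt_tsub_iff_left, ← NNReal.coe_lt_coe] at h3
    push_cast at h3
    have hcl : ∃ z : ℝ≥0, dist l' z ≤ (c : ℝ≥0) / 2 ∧ dist (w.1 r') z < (c : ℝ≥0) / 2 := by
      have htd : ∀ z : ℝ≥0, Tendsto (fun q => dist (w.1 q) z) (𝓝[<] r') (𝓝 (dist l' z)) :=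
        fun z => hl'.dist tendsto_const_nhds
      rcases lt_or_gt_of_ne hne with hlt | hgt
      · refine ⟨l, le_of_tendsto (htd l) ?_, hv' ⟨ha1.trans h1, hlt⟩⟩
        filter_upwards [Ioo_mem_nhdsLT h1] with q hq
        exact (hv' ⟨ha1.trans hq.1, hq.2.trans hlt⟩ : dist (w.1 q) l < _).le
      · refine ⟨w.1 r, le_of_tendsto (htd _) ?_, (hu' ⟨hgt, h2.trans hb2⟩).1⟩
        filter_upwards [Ioo_mem_nhdsLT hgt] with q hq
        exact (hu' ⟨hq.1, hq.2.trans (h2.trans hb2)⟩).1.le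
    obtain ⟨z, hz1, hz2⟩ := hcl
    rw [NNReal.dist_eq, abs_le] at hz1
    rw [NNReal.dist_eq, abs_lt] at hz2
    linarith [hz1.1, hz1.2, hz2.1, hz2.2]
  have : firstJump a b c w = r := by
    refine le_antisymm (iInf₂_le r ⟨ha2, hb1, hc⟩) (le_iInf₂ fun r' h' => ?_)
    rw [huniq r' h'.1 h'.2.1 h'.2.2]
  rw [this, ENNReal.toNNReal_coe]

theorem le_encard_iff {α : Type*} (S : Set α) (n : ℕ) :
    (n : ℕ∞) ≤ S.encard ↔ ∃ g : Fin n → α, Function.Injective g ∧ ∀ j, g j ∈ S := by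
  constructor
  · intro h
    obtain ⟨T, hTS, hT⟩ := Set.exists_subset_encard_eq h
    have hfin : T.Finite := Set.finite_of_encard_eq_coe hT
    have hcard : hfin.toFinset.card = n := by
      rw [hfin.encard_eq_coe_toFinset_card] at hT
      exact_mod_cast hT
    let e := (hfin.toFinset.equivFinOfCardEq hcard).symm
    exact ⟨fun j => (e j).1, fun i j hij => e.injective (Subtype.ext hij),
      fun j => hTS (hfin.mem_toFinset.1 (e j).2)⟩
  · rintro ⟨g, hg, hgS⟩
    have h1 : (Set.range g).encard = n := by
      rw [← Set.image_univ, hg.encard_image, Set.encard_univ]; simp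
    rw [← h1]
    exact Set.encard_le_encard (Set.range_subset_iff.2 hgS)

theorem measurable_rankValue {f : ℝ≥0 → ℝ≥0 → ℝ≥0} (hf : Measurable (Function.uncurry f))
    {σ : CellPath → ℝ≥0} (hσ : Measurable σ) :
    Measurable fun w => f (σ w) (jumpSize w (σ w)) :=
  hf.comp (hσ.prodMk (measurable_jumpSize.comp (measurable_id.prodMk hσ)))

theorem measurableSet_precedes {f : ℝ≥0 → ℝ≥0 → ℝ≥0} (hf : Measurable (Function.uncurry f))
    {σ τ : CellPath → ℝ≥0} (hσ : Measurable σ) (hτ : Measurable τ) :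
    MeasurableSet {w | Precedes f w (σ w) (τ w)} := by
  have h1 : Measurable fun w => jumpSize w (σ w) :=
    measurable_jumpSize.comp (measurable_id.prodMk hσ)
  have h2 : MeasurableSet {w | σ w < τ w} := measurableSet_lt hσ hτ
  exact (h1 (measurableSet_singleton 0)).compl.inter
    ((measurableSet_lt (measurable_rankValue hf hτ) (measurable_rankValue hf hσ)).union
      ((measurableSet_eq_fun (measurable_rankValue hf hσ) (measurable_rankValue hf hτ)).inter
        h2))

theorem measurableSet_isJumpOfRank {f : ℝ≥0 → ℝ≥0 → ℝ≥0} (hf : Measurable (Function.uncurry f))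
    (i : ℕ) {τ : CellPath → ℝ≥0} (hτ : Measurable τ) :
    MeasurableSet {w | IsJumpOfRank f w i (τ w)} := by
  let σ : ℚ≥0 × ℚ≥0 × ℚ≥0 → CellPath → ℝ≥0 := fun k w => (firstJump k.1 k.2.1 k.2.2 w).toNNReal
  have hσ : ∀ k, Measurable (σ k) := fun k => (measurable_firstJump _ _ _).ennreal_toNNReal
  have hle : ∀ n : ℕ, MeasurableSet {w | (n : ℕ∞) ≤ {r' | Precedes f w r' (τ w)}.encard} := by
    intro n
    have : {w | (n : ℕ∞) ≤ {r' | Precedes f w r' (τ w)}.encard} =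
        ⋃ g : Fin n → ℚ≥0 × ℚ≥0 × ℚ≥0, (⋂ j, {w | Precedes f w (σ (g j) w) (τ w)}) ∩
          ⋂ (j) (j'), {w | σ (g j) w = σ (g j') w → j = j'} := by
      ext w
      simp only [Set.mem_ofPred_eq, le_encard_iff, Set.mem_iUnion, Set.mem_inter_iff,
        Set.mem_iInter]
      constructor
      · rintro ⟨g, hg, hgS⟩
        choose a b c h using fun j => exists_firstJump_eq w (hgS j).1
        refine ⟨fun j => (a j, b j, c j), fun j => ?_, fun j j' hjj => hg ?_⟩
        · have h' : σ (a j, b j, c j) w = g j := h j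
          simpa only [h'] using hgS j
        · exact (h j).symm.trans (hjj.trans (h j'))
      · rintro ⟨g, h1, h2⟩
        exact ⟨fun j => σ (g j) w, fun j j' h => h2 j j' h, h1⟩
    rw [this]
    refine .iUnion fun g => .inter (.iInter fun j => measurableSet_precedes hf (hσ _) hτ)
      (.iInter fun j => .iInter fun j' => ?_)
    exact (measurableSet_eq_fun (hσ _) (hσ _)).imp (.const _)
  have : {w | IsJumpOfRank f w i (τ w)} = {w | jumpSize w (τ w) ≠ 0} ∩
      ({w | (i : ℕ∞) ≤ {r' | Precedes f w r' (τ w)}.encard} \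
        {w | ((i + 1 : ℕ) : ℕ∞) ≤ {r' | Precedes f w r' (τ w)}.encard}) := by
    ext w
    simp only [IsJumpOfRank, Set.mem_ofPred_eq, Set.mem_inter_iff, Set.mem_sdiff, and_congr_right_iff]
    intro _
    generalize {r' | Precedes f w r' (τ w)}.encard = N
    push_cast
    rw [not_le, ENat.lt_add_one_iff (ENat.natCast_ne_top i)]
    exact ⟨fun h => ⟨h.ge, h.le⟩, fun h => le_antisymm h.2 h.1⟩
  rw [this]
  exact ((measurable_jumpSize.comp (measurable_id.prodMk hτ))
    (measurableSet_singleton 0)).compl.inter ((hle i).diff (hle (i + 1)))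

theorem measurable_jumpTime {f : ℝ≥0 → ℝ≥0 → ℝ≥0} (hf : Measurable (Function.uncurry f))
    (i : ℕ) : Measurable (jumpTime f i) := by
  let σ : ℚ≥0 × ℚ≥0 × ℚ≥0 → CellPath → ℝ≥0 := fun k w => (firstJump k.1 k.2.1 k.2.2 w).toNNReal
  have hσ : ∀ k, Measurable (σ k) := fun k => (measurable_firstJump _ _ _).ennreal_toNNReal
  refine measurable_of_Iio fun z => ?_
  have : jumpTime f i ⁻¹' Set.Iio z =
      ⋃ k, {w | IsJumpOfRank f w i (σ k w)} ∩ {w | (σ k w : ℝ≥0∞) < z} := by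
    ext w
    simp only [jumpTime, Set.mem_preimage, Set.mem_Iio, iInf_lt_iff, Set.mem_ofPred_eq,
      Set.mem_iUnion, Set.mem_inter_iff]
    constructor
    · rintro ⟨r, h1, h2⟩
      obtain ⟨a, b, c, h⟩ := exists_firstJump_eq w h1.1
      have h : σ (a, b, c) w = r := h
      exact ⟨(a, b, c), by rwa [h], by rwa [h]⟩
    · rintro ⟨k, h1, h2⟩
      exact ⟨_, h1, h2⟩
  rw [this]
  exact .iUnion fun k => (measurableSet_isJumpOfRank hf i (hσ k)).inter
    (measurableSet_lt (hσ k).coe_nnreal_ennreal measurable_const)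

theorem measurable_childSize {f : ℝ≥0 → ℝ≥0 → ℝ≥0} (hf : Measurable (Function.uncurry f))
    (i : ℕ) : Measurable (childSize f i) :=
  Measurable.ite (measurable_jumpTime hf i (measurableSet_singleton ⊤)) measurable_const
    (measurable_jumpSize.comp (measurable_id.prodMk (measurable_jumpTime hf i).ennreal_toNNReal))

/-- A product of Markov kernels with the same source is measurable in the source. -/
theorem measurable_infinitePi {ι α β : Type*} [MeasurableSpace α] [MeasurableSpace β]
    (κ : ι → Kernel α β) [∀ i, IsMarkovKernel (κ i)] :
    Measurable fun a => Measure.infinitePi fun i => κ i a := by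
  refine .measure_of_isPiSystem_of_isProbabilityMeasure generateFrom_squareCylinders.symm
    (isPiSystem_squareCylinders (fun _ => MeasurableSpace.isPiSystem_measurableSet)
      fun _ => MeasurableSet.univ) ?_
  rintro s ⟨I, S, hS, rfl⟩
  have hS : ∀ i, MeasurableSet (S i) := by simpa [Set.mem_pi] using hS
  have : ∀ a, (Measure.infinitePi fun i => κ i a) ((I : Set ι).pi S) = ∏ i ∈ I, κ i a (S i) :=
    fun a => Measure.infinitePi_pi _ fun i _ => hS i
  simp only [this]
  exact Finset.measurable_prod _ fun i _ => (κ i).measurable_coe (hS i)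

/-- The information carried by the path up to time `s`. -/
abbrev past (s : ℝ≥0) : MeasurableSpace CellPath :=
  ⨆ (r : ℝ≥0) (_ : r ≤ s), MeasurableSpace.comap (fun w : CellPath => w.1 r) inferInstance

/-- Extension of a function on `(0, ∞)` by `0` at `∂`. -/
noncomputable def extendZero (g : Set.Ioi (0 : ℝ≥0) → ℝ) (x : ℝ≥0) : ℝ :=
  if h : 0 < x then g ⟨x, h⟩ else 0

/-- A cell process: a time-homogeneous Feller process on `(0, ∞) ∪ {∂}` whose paths are cell paths;
`law x` is its law `P_x` when it starts from `x` (and `law 0` belongs to the dead path).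
The Feller property is asked for in the form that the semigroup maps `C₀(0, ∞)` to continuous
functions on `(0, ∞)`; this is implied by each of the usual forms (`C₀` to `C₀`, `C_b` to `C_b`). -/
structure CellProc where
  law : Kernel ℝ≥0 CellPath
  isMarkovKernel : IsMarkovKernel law
  start : ∀ x, ∀ᵐ w ∂law x, w.1 0 = x
  markov : ∀ (x s : ℝ≥0) (A B : Set CellPath), MeasurableSet[past s] A → MeasurableSet B →
    law x (A ∩ shift s ⁻¹' B) = ∫⁻ w in A, law (w.1 s) B ∂law x
  feller : ∀ (t : ℝ≥0) (g : C₀(Set.Ioi (0 : ℝ≥0), ℝ)),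
    Continuous fun x : Set.Ioi (0 : ℝ≥0) => ∫ w, extendZero g (w.1 t) ∂law (x : ℝ≥0)

instance (X : CellProc) : IsMarkovKernel X.law := X.isMarkovKernel

/-- A measurable function `f : [0, ∞) × ((0, ∞) ∪ {∂}) → [0, ∞)` that vanishes at `∂` and has a
positive infimum over `{r < l, x > a}` for all `a, l > 0`. -/
structure Gauge where
  toFun : ℝ≥0 → ℝ≥0 → ℝ≥0
  measurable : Measurable (Function.uncurry toFun)
  cemetery : ∀ r, toFun r 0 = 0
  inf_pos : ∀ a l : ℝ≥0, 0 < a → 0 < l → ∃ c > 0, ∀ r x, r < l → a < x → c ≤ toFun r x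

/-- Hypothesis [H] for `X` with the function `f`:
`E_x[f(s+t, X(t)) + ∑_{0 ≤ r ≤ t} f(s+r, -ΔX(r))] ≤ f(s, x)`, the sum being over the jump times
(`f` vanishes at the other times, where `jumpSize` is `∂`). -/
def CellProc.HypH (X : CellProc) (f : Gauge) : Prop :=
  ∀ x s t : ℝ≥0, 0 < x →
    ∫⁻ w, ((f.toFun (s + t) (w.1 t) : ℝ≥0∞) +
      ∑' r : Set.Iic t, (f.toFun (s + r) (jumpSize w r) : ℝ≥0∞)) ∂X.law x ≤ f.toFun s x

/-- The cells of generation `n`, indexed by the words of length `n`. -/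
abbrev Generation (n : ℕ) : Type := (Fin n → ℕ) → CellPath

/-- A family of cell paths indexed by the Ulam-Harris tree, generation by generation. -/
abbrev CellSystem : Type := (n : ℕ) → Generation n

theorem measurable_childSizes (f : Gauge) (n : ℕ) (v : Fin (n + 1) → ℕ) :
    Measurable fun h : (i : Finset.Iic n) → Generation i =>
      childSize f.toFun (v (Fin.last n)) (h ⟨n, Finset.mem_Iic.2 le_rfl⟩ (Fin.init v)) :=
  (measurable_childSize f.measurable _).comp
    ((measurable_pi_apply (Fin.init v)).comp (measurable_pi_apply _))

/-- Given the first `n` generations, the cells of generation `n + 1` are independent, and the cell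
`vi` has the law of the cell process started from the size of the `i`-th jump of the cell `v`. -/
noncomputable def CellProc.offspring (X : CellProc) (f : Gauge) (n : ℕ) :
    Kernel ((i : Finset.Iic n) → Generation i) (Generation (n + 1)) where
  toFun h := Measure.infinitePi fun v : Fin (n + 1) → ℕ =>
    X.law (childSize f.toFun (v (Fin.last n)) (h ⟨n, Finset.mem_Iic.2 le_rfl⟩ (Fin.init v)))
  measurable' := measurable_infinitePi fun v : Fin (n + 1) → ℕ =>
    X.law.comap _ (measurable_childSizes f n v)

instance (X : CellProc) (f : Gauge) (n : ℕ) : IsMarkovKernel (X.offspring f n) :=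
  ⟨fun h => inferInstanceAs (IsProbabilityMeasure (Measure.infinitePi fun v : Fin (n + 1) → ℕ =>
    X.law (childSize f.toFun (v (Fin.last n)) (h ⟨n, Finset.mem_Iic.2 le_rfl⟩ (Fin.init v)))))⟩

/-- The generation `0` that consists of the given ancestor. -/
def ancestor (w : CellPath) : (i : Finset.Iic 0) → Generation i := fun _ _ => w

theorem measurable_ancestor : Measurable ancestor :=
  measurable_pi_lambda _ fun _ => measurable_pi_lambda _ fun _ => measurable_id

/-- The law of the cell system driven by `X` as a function of the initial size `x` of the
ancestor: the ancestor has law `P_x`, the further generations are added one after the other. -/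
noncomputable def CellProc.systemLaw (X : CellProc) (f : Gauge) : Kernel ℝ≥0 CellSystem :=
  Kernel.traj (X := Generation) (X.offspring f) 0 ∘ₖ X.law.map ancestor

instance (X : CellProc) (f : Gauge) : IsMarkovKernel (X.systemLaw f) := by
  have := Kernel.IsMarkovKernel.map X.law measurable_ancestor
  unfold CellProc.systemLaw
  infer_instance

/-- The birth time of a cell. -/
noncomputable def birthTime (f : Gauge) (C : CellSystem) : (n : ℕ) → (Fin n → ℕ) → ℝ≥0∞
  | 0, _ => 0
  | n + 1, v => birthTime f C n (Fin.init v) +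
      jumpTime f.toFun (v (Fin.last n)) (C n (Fin.init v))

/-- The multiset `{y}`, as a point measure, and the empty multiset if `y = ∂`. -/
noncomputable def atom (y : ℝ≥0) : Measure ℝ≥0 :=
  if y = 0 then 0 else Measure.dirac y

/-- The multiset `𝐗(t)` of the sizes of the cells alive at time `t`, as a point measure. A cell `u`
born at `b_u ≤ t` is alive at time `t` if and only if its size at age `t - b_u` is not `∂`. -/
noncomputable def growthFrag (f : Gauge) (t : ℝ≥0) (C : CellSystem) : Measure ℝ≥0 :=
  Measure.sum fun u : (n : ℕ) × (Fin n → ℕ) =>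
    if birthTime f C u.1 u.2 ≤ t then
      atom ((C u.1 u.2).1 (t - (birthTime f C u.1 u.2).toNNReal))
    else 0

/-- The multiset on `(0, ∞)` enumerated by `y`; the indices `i` with `y i = ∂` do not count. -/
noncomputable def ofSeq (y : ℕ → ℝ≥0) : Measure ℝ≥0 :=
  Measure.sum fun i => atom (y i)

/-- The set of the multisets `J` on `(0, ∞)` with `∑_{y ∈ J} f(s, y) < ∞`. -/
def Gauge.multisets (f : Gauge) (s : ℝ≥0) : Set (Measure ℝ≥0) :=
  {J | (∃ y, J = ofSeq y) ∧ ∫⁻ z, (f.toFun s z : ℝ≥0∞) ∂J < ∞}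

/-- The law of the sum of the multisets `𝐗ᵢ(t)`, where the growth-fragmentations `𝐗ᵢ` are
independent and `𝐗ᵢ` starts from a cell of size `y i` (and is empty if `y i = ∂`). -/
noncomputable def CellProc.branchLaw (X : CellProc) (f : Gauge) (t : ℝ≥0) (y : ℕ → ℝ≥0) :
    Measure (Measure ℝ≥0) :=
  (Measure.infinitePi fun i => X.systemLaw f (y i)).map
    fun C => Measure.sum fun i => growthFrag f t (C i)

open Classical in
/-- `ρ_{s,t}(J, ·)`: the elements of the multiset `J` evolve as independent growth-fragmentations
during the time `t - s`. -/
noncomputable def CellProc.rho (X : CellProc) (f : Gauge) (s t : ℝ≥0) (J : Measure ℝ≥0) :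
    Measure (Measure ℝ≥0) :=
  if h : ∃ y, J = ofSeq y then X.branchLaw f (t - s) h.choose else 0

/-- The σ-algebra generated by `(𝐗(r), 0 ≤ r ≤ s)`. -/
noncomputable abbrev history (f : Gauge) (s : ℝ≥0) : MeasurableSpace CellSystem :=
  ⨆ (r : ℝ≥0) (_ : r ≤ s), MeasurableSpace.comap (growthFrag f r) inferInstance

end GrowthFrag

/-! Let Φ be the sum over all cells of a nonnegative functional φ of the birth time and the path. It
is studied through its cumulant -log E[e^{-Φ}], a logarithmic mean `logMean`. This mean takes values
in [0, ∞], is additive over independent terms and continuous along increasing sequences, so no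
integrability condition ever appears. Given the path of the ancestor, the families of its daughters
are independent. Hence the cumulant of the whole system is the limit of a recursion (`cumulant`):
add to φ of the ancestor the cumulants of its daughters, and take the logarithmic mean under P_x
(`logMean_tsum_genSum`).

The recursion sums over the jumps of a path as an unordered set, so labels disappear. Labels are
what obstructs a direct argument: the posterity after time s of a cell alive at s is not a subtree
of the cell system, and the later jumps of that cell would be ranked differently in the path
restarted at s. On cumulants the branching property reads (`cumulantLim_branching`): if φ depends
only on the paths up to time s, adding the sum of h over the population at time t has the same
effect as adding the sum of u over the population at time s, where u(y) is the cumulant of the sum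
of h at time t - s for an ancestor of size y. It follows by cutting every path at time s and using
the Markov property of a single cell (`logMean_stopAt_shift`).

Hypothesis [H] enters twice. The f-weights of the jumps have a finite expected sum, so the ranking
lists all jumps (`ae_listed`). The f-weight of the population is a supermartingale
(`lintegral_growthFrag_le`), which gives membership in the spaces of multisets. Since f is bounded
below away from 0, such multisets have finitely many points above each positive level; their
decreasing enumeration is measurable in the point measure, and this makes ρ measurable.

To reach conditional laws, the exponentials e^{-Φ} of functionals of the past form a multiplicative
class generating the history. Finite measures that agree on such a class are equal, because the
moment problem on [0, 1] is determinate (`ext_of_mul_closed`). This principle is used once for the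
law of 𝐗(t) and once for the history. -/

namespace GrowthFrag

/-! ### The exponential `x ↦ e^{-x}` on `[0, ∞]` and its inverse -/

/-- `e^{-x}` for `x ∈ [0, ∞]`. -/
noncomputable def expNeg (x : ℝ≥0∞) : ℝ≥0∞ := EReal.exp (-(x : EReal))

/-- `-log y`, for `y ∈ [0, 1]`. -/
noncomputable def negLog (y : ℝ≥0∞) : ℝ≥0∞ := (-(ENNReal.log y)).toENNReal

theorem continuous_expNeg : Continuous expNeg :=
  ENNReal.continuous_exp.comp (continuous_neg.comp continuous_coe_ennreal_ereal)

theorem measurable_expNeg : Measurable expNeg := continuous_expNeg.measurable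

theorem antitone_expNeg : Antitone expNeg := fun _ _ h =>
  EReal.exp_monotone (EReal.neg_le_neg_iff.2 (EReal.coe_ennreal_le_coe_ennreal_iff.2 h))

@[simp] theorem expNeg_zero : expNeg 0 = 1 := by simp [expNeg]

theorem expNeg_le_one (x : ℝ≥0∞) : expNeg x ≤ 1 := by
  simpa using antitone_expNeg (zero_le (a := x))

theorem expNeg_add (x y : ℝ≥0∞) : expNeg (x + y) = expNeg x * expNeg y := by
  rw [expNeg, EReal.coe_ennreal_add, EReal.neg_add (by simp) (by simp), sub_eq_add_neg,
    EReal.exp_add]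
  rfl

theorem expNeg_sum {ι : Type*} (s : Finset ι) (a : ι → ℝ≥0∞) :
    expNeg (∑ i ∈ s, a i) = ∏ i ∈ s, expNeg (a i) := by
  classical
  induction s using Finset.induction_on with
  | empty => simp
  | insert i s hi ih => rw [Finset.sum_insert hi, Finset.prod_insert hi, expNeg_add, ih]

theorem expNeg_iSup {ι : Type*} [Nonempty ι] (a : ι → ℝ≥0∞) :
    expNeg (⨆ i, a i) = ⨅ i, expNeg (a i) :=
  antitone_expNeg.map_ciSup_of_continuousAt continuous_expNeg.continuousAt (OrderTop.bddAbove _)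

@[simp] theorem negLog_expNeg (x : ℝ≥0∞) : negLog (expNeg x) = x := by
  simp [negLog, expNeg]

theorem expNeg_negLog {y : ℝ≥0∞} (h : y ≤ 1) : expNeg (negLog y) = y := by
  rw [expNeg, negLog, EReal.coe_toENNReal, neg_neg, ENNReal.exp_log]
  rw [← neg_zero]
  exact EReal.neg_le_neg_iff.2 (ENNReal.log_le_zero_iff.2 h)

theorem antitone_negLog : Antitone negLog := fun _ _ h =>
  EReal.toENNReal_le_toENNReal (EReal.neg_le_neg_iff.2 (ENNReal.log_monotone h))

theorem measurable_negLog : Measurable negLog :=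
  (continuous_neg.measurable.comp ENNReal.measurable_log).ereal_toENNReal

theorem expNeg_injective : Function.Injective expNeg :=
  Function.LeftInverse.injective negLog_expNeg

/-- The logarithmic mean `-log ∫ e^{-ξ} dμ`. -/
noncomputable def logMean {α : Type*} [MeasurableSpace α] (μ : Measure α) (ξ : α → ℝ≥0∞) : ℝ≥0∞ :=
  negLog (∫⁻ a, expNeg (ξ a) ∂μ)

section logMean

variable {α β : Type*} [MeasurableSpace α] [MeasurableSpace β]

theorem lintegral_expNeg_le_one (μ : Measure α) [IsProbabilityMeasure μ] (ξ : α → ℝ≥0∞) :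
    ∫⁻ a, expNeg (ξ a) ∂μ ≤ 1 :=
  (lintegral_mono fun a => expNeg_le_one (ξ a)).trans (by simp)

theorem expNeg_logMean (μ : Measure α) [IsProbabilityMeasure μ] (ξ : α → ℝ≥0∞) :
    expNeg (logMean μ ξ) = ∫⁻ a, expNeg (ξ a) ∂μ :=
  expNeg_negLog (lintegral_expNeg_le_one μ ξ)

theorem logMean_mono (μ : Measure α) {ξ η : α → ℝ≥0∞} (h : ∀ a, ξ a ≤ η a) :
    logMean μ ξ ≤ logMean μ η :=
  antitone_negLog (lintegral_mono fun a => antitone_expNeg (h a))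

theorem logMean_congr {μ : Measure α} {ξ η : α → ℝ≥0∞} (h : ξ =ᵐ[μ] η) :
    logMean μ ξ = logMean μ η := by
  rw [logMean, logMean, lintegral_congr_ae (h.mono fun a ha => by rw [ha])]

theorem logMean_const (μ : Measure α) [IsProbabilityMeasure μ] (c : ℝ≥0∞) :
    logMean μ (fun _ => c) = c := by
  simp [logMean]

theorem logMean_map {μ : Measure α} {F : α → β} (hF : Measurable F) {ξ : β → ℝ≥0∞}
    (hξ : Measurable ξ) : logMean (μ.map F) ξ = logMean μ fun a => ξ (F a) :=
  congrArg negLog (lintegral_map (measurable_expNeg.comp hξ) hF)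

/-- The exponentials decrease and are bounded by 1, so under a probability measure their infimum
passes through the integral, even where the functionals reach ∞. -/
theorem logMean_iSup (μ : Measure α) [IsProbabilityMeasure μ] {ξ : ℕ → α → ℝ≥0∞}
    (hm : ∀ n, Measurable (ξ n)) (hξ : Monotone ξ) :
    logMean μ (fun a => ⨆ n, ξ n a) = ⨆ n, logMean μ (ξ n) := by
  apply expNeg_injective
  rw [expNeg_iSup, expNeg_logMean]
  simp only [expNeg_logMean, expNeg_iSup]
  refine lintegral_iInf (fun n => measurable_expNeg.comp (hm n))
    (fun m n h a => antitone_expNeg (hξ h a)) ?_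
  exact ((lintegral_expNeg_le_one μ _).trans_lt ENNReal.one_lt_top).ne

theorem measurable_logMean {γ : Type*} [MeasurableSpace γ] (κ : Kernel α β) [IsSFiniteKernel κ]
    {g : γ → α} (hg : Measurable g) {ξ : γ → β → ℝ≥0∞} (hξ : Measurable (Function.uncurry ξ)) :
    Measurable fun c => logMean (κ (g c)) (ξ c) := by
  have : Measurable fun c => ∫⁻ b, expNeg (ξ c b) ∂(κ.comap g hg) c :=
    Measurable.lintegral_kernel_prod_right' (measurable_expNeg.comp hξ)
  exact measurable_negLog.comp this

theorem lintegral_eval_infinitePi {ι : Type*} {E : ι → Type*} [∀ i, MeasurableSpace (E i)]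
    {μ : ∀ i, Measure (E i)} [∀ i, IsProbabilityMeasure (μ i)] (i : ι) {g : E i → ℝ≥0∞}
    (hg : Measurable g) : ∫⁻ x, g (x i) ∂Measure.infinitePi μ = ∫⁻ a, g a ∂μ i :=
  (measurePreserving_eval_infinitePi μ i).lintegral_comp hg

/-- The logarithmic mean is additive on independent coordinates. -/
theorem logMean_infinitePi {ι : Type*} [Countable ι] {E : ι → Type*}
    [∀ i, MeasurableSpace (E i)] (μ : ∀ i, Measure (E i)) [∀ i, IsProbabilityMeasure (μ i)]
    {ξ : ∀ i, E i → ℝ≥0∞} (hξ : ∀ i, Measurable (ξ i)) :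
    logMean (Measure.infinitePi μ) (fun x => ∑' i, ξ i (x i)) = ∑' i, logMean (μ i) (ξ i) := by
  have hfin : ∀ s : Finset ι, logMean (Measure.infinitePi μ) (fun x => ∑ i ∈ s, ξ i (x i)) =
      ∑ i ∈ s, logMean (μ i) (ξ i) := fun s => by
    apply expNeg_injective
    rw [expNeg_logMean, expNeg_sum]
    simp only [expNeg_sum, expNeg_logMean]
    refine (lintegral_prod_eq_prod_lintegral_of_indepFun s
      (fun i (x : ∀ i, E i) => expNeg (ξ i (x i))) ?_ ?_).trans ?_
    rotate_left 2
    · exact Finset.prod_congr rfl fun i _ =>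
        lintegral_eval_infinitePi i (measurable_expNeg.comp (hξ i))
    · exact iIndepFun_infinitePi fun i => measurable_expNeg.comp (hξ i)
    · exact fun i => (measurable_expNeg.comp (hξ i)).comp (measurable_pi_apply i)
  rcases isEmpty_or_nonempty ι with h | h
  · simp [logMean_const]
  obtain ⟨e, he⟩ := exists_surjective_nat ι
  classical
  -- The images of the initial segments of ℕ are an increasing cofinal sequence of finite sets;
  -- `logMean_iSup` needs a sequence, not the net of all finite sets.
  let s : ℕ → Finset ι := fun n => (Finset.range n).image e
  have hs : Monotone s := fun m n h => Finset.image_subset_image (Finset.range_subset_range.2 h)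
  have hcov : ∀ t : Finset ι, ∃ n, t ⊆ s n := fun t => by
    choose k hk using he
    refine ⟨t.sup k + 1, fun i hi => Finset.mem_image.2 ⟨k i, ?_, hk i⟩⟩
    exact Finset.mem_range.2 (Nat.lt_succ_of_le (Finset.le_sup hi))
  have hsum : ∀ a : ι → ℝ≥0∞, ∑' i, a i = ⨆ n, ∑ i ∈ s n, a i := fun a =>
    ENNReal.tsum_eq_iSup_sum' s hcov
  simp only [hsum]
  rw [logMean_iSup]
  · simp only [hfin]
  · exact fun n => Finset.measurable_sum _ fun i _ => (hξ i).comp (measurable_pi_apply i)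
  · exact fun m n h x => Finset.sum_le_sum_of_subset (hs h)

end logMean

/-- Monotone convergence for the counting measure on the discrete σ-algebra. The index set may be
uncountable, as for sums over all times of a path. -/
theorem tsum_iSup_of_monotone {ι : Type*} {a : ℕ → ι → ℝ≥0∞} (ha : Monotone a) :
    ∑' i, ⨆ n, a n i = ⨆ n, ∑' i, a n i := by
  let _ : MeasurableSpace ι := ⊤
  have hc : ∀ b : ι → ℝ≥0∞, ∑' i, b i = ∫⁻ i, b i ∂Measure.count := fun b =>
    (lintegral_count' measurable_from_top).symm
  simp only [hc]
  exact lintegral_iSup (fun n => measurable_from_top) ha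

/-! ### Finite measures are determined by a multiplicative class of functions -/

theorem integral_polynomial_eval {P : Measure ℝ} [IsFiniteMeasure P]
    (hP : ∀ᵐ x ∂P, x ∈ Set.Icc (0 : ℝ) 1) (p : Polynomial ℝ) :
    Integrable (fun x => p.eval x) P ∧
      ∫ x, p.eval x ∂P = p.sum fun n a => a * ∫ x, x ^ n ∂P := by
  have hint : ∀ n : ℕ, Integrable (fun x : ℝ => x ^ n) P := fun n =>
    Integrable.of_bound (by fun_prop) 1 (hP.mono fun x hx => by
      rw [Real.norm_eq_abs, abs_of_nonneg (pow_nonneg hx.1 n)]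
      exact pow_le_one₀ hx.1 hx.2)
  have hint' : ∀ n ∈ p.support, Integrable (fun x : ℝ => p.coeff n * x ^ n) P := fun n _ =>
    (hint n).const_mul _
  simp only [Polynomial.eval_eq_sum, Polynomial.sum]
  refine ⟨integrable_finsetSum _ hint', ?_⟩
  rw [integral_finsetSum _ hint']
  simp only [integral_const_mul]

/-- The moment problem on `[0, 1]` is determinate. -/
theorem ext_of_moments {P Q : Measure ℝ} [IsFiniteMeasure P] [IsFiniteMeasure Q]
    (hP : ∀ᵐ x ∂P, x ∈ Set.Icc (0 : ℝ) 1) (hQ : ∀ᵐ x ∂Q, x ∈ Set.Icc (0 : ℝ) 1)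
    (h : ∀ n : ℕ, ∫ x, x ^ n ∂P = ∫ x, x ^ n ∂Q) : P = Q := by
  refine ext_of_forall_integral_eq_of_IsFiniteMeasure fun g => ?_
  have hpoly : ∀ p : Polynomial ℝ, ∫ x, p.eval x ∂P = ∫ x, p.eval x ∂Q := fun p => by
    rw [(integral_polynomial_eval hP p).2, (integral_polynomial_eval hQ p).2]
    simp only [h]
  have happrox : ∀ (τ : Measure ℝ) [IsFiniteMeasure τ], (∀ᵐ x ∂τ, x ∈ Set.Icc (0 : ℝ) 1) →
      ∀ (p : Polynomial ℝ) (ε : ℝ), (∀ x ∈ Set.Icc (0 : ℝ) 1, |p.eval x - g x| < ε) →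
      |∫ x, p.eval x ∂τ - ∫ x, g x ∂τ| ≤ ε * τ.real Set.univ := fun τ _ hR p ε hp => by
    rw [← integral_sub (integral_polynomial_eval hR p).1 (g.integrable τ)]
    have hb : ∀ᵐ x ∂τ, ‖p.eval x - g x‖ ≤ ε := hR.mono fun x hx => (hp x hx).le
    exact norm_integral_le_of_norm_le_const hb
  have hle : ∀ ε > 0, |∫ x, g x ∂P - ∫ x, g x ∂Q| ≤
      ε * (P.real Set.univ + Q.real Set.univ) := fun ε hε => by
    -- By Weierstrass, g is uniformly close on [0, 1], which carries both measures, to a polynomial,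
    -- and the moments fix the integral of the latter.
    obtain ⟨p, hp⟩ := exists_polynomial_near_of_continuousOn 0 1 g g.continuous.continuousOn ε hε
    have h1 := happrox P hP p ε hp
    have h2 := happrox Q hQ p ε hp
    rw [hpoly p] at h1
    rw [abs_le] at h1 h2 ⊢
    constructor <;> linarith [h1.1, h1.2, h2.1, h2.2]
  have h0 : |∫ x, g x ∂P - ∫ x, g x ∂Q| ≤ 0 := by
    have ht : Tendsto (fun ε : ℝ => ε * (P.real Set.univ + Q.real Set.univ)) (𝓝[>] 0) (𝓝 0) := by
      have : Tendsto (fun ε : ℝ => ε * (P.real Set.univ + Q.real Set.univ)) (𝓝 0)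
          (𝓝 (0 * (P.real Set.univ + Q.real Set.univ))) := tendsto_id.mul_const _
      rw [zero_mul] at this
      exact this.mono_left nhdsWithin_le_nhds
    exact ge_of_tendsto ht (eventually_nhdsWithin_of_forall hle)
  exact sub_eq_zero.1 (abs_eq_zero.1 (le_antisymm h0 (abs_nonneg _)))

theorem pow_mul_mem_of_mul_closed {Ω : Type*} {𝒦 : Set (Ω → ℝ≥0∞)}
    (hmul : ∀ k ∈ 𝒦, ∀ l ∈ 𝒦, (fun ω => k ω * l ω) ∈ 𝒦)
    {k l : Ω → ℝ≥0∞} (hk : k ∈ 𝒦) (hl : l ∈ 𝒦) (n : ℕ) : (fun ω => k ω * l ω ^ n) ∈ 𝒦 := by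
  induction n with
  | zero => simpa using hk
  | succ n ih =>
    convert hmul _ ih l hl using 2 with ω
    ring

section MulClosed

variable {Ω : Type*} [m : MeasurableSpace Ω] {𝒦 : Set (Ω → ℝ≥0∞)}

/-- The image under l of the measure with density k lives on [0, 1], and its n-th moment is the
integral of k lⁿ. Since k lⁿ is in the class, these moments agree for μ and ν, hence so do the
images. -/
theorem setLIntegral_eq_of_mul_closed (hle : ∀ k ∈ 𝒦, ∀ ω, k ω ≤ 1)
    (hmul : ∀ k ∈ 𝒦, ∀ l ∈ 𝒦, (fun ω => k ω * l ω) ∈ 𝒦) (hmeas : ∀ k ∈ 𝒦, Measurable k)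
    {μ ν : Measure Ω} [IsFiniteMeasure μ] [IsFiniteMeasure ν]
    (h : ∀ k ∈ 𝒦, ∫⁻ ω, k ω ∂μ = ∫⁻ ω, k ω ∂ν) {k l : Ω → ℝ≥0∞} (hk : k ∈ 𝒦) (hl : l ∈ 𝒦)
    {S : Set Ω} (hS : MeasurableSet[MeasurableSpace.comap l inferInstance] S) :
    ∫⁻ ω in S, k ω ∂μ = ∫⁻ ω in S, k ω ∂ν := by
  obtain ⟨T, hT, rfl⟩ := hS
  have hl' : Measurable fun ω => (l ω).toReal := (hmeas l hl).ennreal_toReal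
  have hfin : ∀ (τ : Measure Ω) [IsFiniteMeasure τ], IsFiniteMeasure (τ.withDensity k) :=
    fun τ _ => isFiniteMeasure_withDensity
      (((lintegral_mono (hle k hk)).trans_lt (by simp)).ne)
  have := hfin μ
  have := hfin ν
  have hsupp : ∀ τ : Measure Ω,
      ∀ᵐ x ∂(τ.withDensity k).map fun ω => (l ω).toReal, x ∈ Set.Icc (0 : ℝ) 1 := fun τ => by
    refine (ae_map_iff hl'.aemeasurable measurableSet_Icc).2 ?_
    refine .of_forall fun ω => ⟨ENNReal.toReal_nonneg, ?_⟩
    simpa using ENNReal.toReal_mono ENNReal.one_ne_top (hle l hl ω)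
  have hmom : ∀ (τ : Measure Ω) [IsFiniteMeasure τ] (n : ℕ),
      ∫ x, x ^ n ∂(τ.withDensity k).map (fun ω => (l ω).toReal) =
        (∫⁻ ω, k ω * l ω ^ n ∂τ).toReal := fun τ _ n => by
    rw [integral_map hl'.aemeasurable (by fun_prop)]
    simp only [← ENNReal.toReal_pow]
    rw [integral_toReal ((hmeas l hl).pow_const n).aemeasurable,
      lintegral_withDensity_eq_lintegral_mul _ (hmeas k hk) ((hmeas l hl).pow_const n)]
    · rfl
    · exact .of_forall fun ω => ENNReal.pow_lt_top ((hle l hl ω).trans_lt ENNReal.one_lt_top)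
  have heq := ext_of_moments (hsupp μ) (hsupp ν) fun n => by
    rw [hmom, hmom, h _ (pow_mul_mem_of_mul_closed hmul hk hl n)]
  have hpre : l ⁻¹' T = (fun ω => (l ω).toReal) ⁻¹' (ENNReal.ofReal ⁻¹' T) := by
    ext ω
    simp [ENNReal.ofReal_toReal ((hle l hl ω).trans_lt ENNReal.one_lt_top).ne]
  have hT' : MeasurableSet (ENNReal.ofReal ⁻¹' T) := ENNReal.measurable_ofReal hT
  rw [← withDensity_apply _ (hmeas l hl hT), ← withDensity_apply _ (hmeas l hl hT), hpre,
    ← Measure.map_apply hl' hT', ← Measure.map_apply hl' hT', heq]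

/-- Two finite measures that agree on a multiplicative class of functions with values in `[0, 1]`
agree on the `σ`-algebra that it generates. -/
theorem ext_of_mul_closed (hle : ∀ k ∈ 𝒦, ∀ ω, k ω ≤ 1) (hone : (fun _ => 1) ∈ 𝒦)
    (hmul : ∀ k ∈ 𝒦, ∀ l ∈ 𝒦, (fun ω => k ω * l ω) ∈ 𝒦) (hmeas : ∀ k ∈ 𝒦, Measurable k)
    (hgen : m ≤ ⨆ k ∈ 𝒦, MeasurableSpace.comap k inferInstance)
    {μ ν : Measure Ω} [IsFiniteMeasure μ] [IsFiniteMeasure ν]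
    (h : ∀ k ∈ 𝒦, ∫⁻ ω, k ω ∂μ = ∫⁻ ω, k ω ∂ν) : μ = ν := by
  have hgen' : m = ⨆ k ∈ 𝒦, MeasurableSpace.comap k inferInstance :=
    le_antisymm hgen (iSup₂_le fun k hk => (hmeas k hk).comap_le)
  have huniv : ∀ μ ν : Measure Ω, (∀ k ∈ 𝒦, ∫⁻ ω, k ω ∂μ = ∫⁻ ω, k ω ∂ν) →
      μ Set.univ = ν Set.univ := fun μ ν h => by simpa using h _ hone
  -- Induction on the number of factors: restricting both measures to `F l` preserves their
  -- agreement on the class, which is why μ and ν are quantified inside the claim.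
  have key : ∀ (t : Finset (Ω → ℝ≥0∞)) (F : (Ω → ℝ≥0∞) → Set Ω), ↑t ⊆ 𝒦 →
      (∀ k ∈ t, MeasurableSet[MeasurableSpace.comap k inferInstance] (F k)) →
      ∀ (μ ν : Measure Ω) [IsFiniteMeasure μ] [IsFiniteMeasure ν],
      (∀ k ∈ 𝒦, ∫⁻ ω, k ω ∂μ = ∫⁻ ω, k ω ∂ν) → μ (⋂ k ∈ t, F k) = ν (⋂ k ∈ t, F k) := by
    classical
    intro t F
    induction t using Finset.induction_on with
    | empty =>
      intro _ _ μ ν _ _ h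
      simpa using huniv μ ν h
    | insert l t hlt ih =>
      intro ht hF μ ν _ _ h
      have hl : l ∈ 𝒦 := ht (Finset.mem_insert_self l t)
      have hFm : ∀ k ∈ t, MeasurableSet (F k) := fun k hk => by
        obtain ⟨T, hT, hTF⟩ := hF k (Finset.mem_insert_of_mem hk)
        have := hmeas k (ht (Finset.mem_insert_of_mem hk)) hT
        rwa [hTF] at this
      have := ih (fun k hk => ht (Finset.mem_insert_of_mem hk))
        (fun k hk => hF k (Finset.mem_insert_of_mem hk)) (μ.restrict (F l)) (ν.restrict (F l))
        (fun k hk => setLIntegral_eq_of_mul_closed hle hmul hmeas h hk hl (hF l (Finset.mem_insert_self l t)))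
      rw [Measure.restrict_apply (t.measurableSet_biInter hFm),
        Measure.restrict_apply (t.measurableSet_biInter hFm)] at this
      rw [Finset.set_biInter_insert, Set.inter_comm, this]
  refine ext_of_generate_finite _ (hgen'.trans (generateFrom_piiUnionInter_measurableSet _ 𝒦).symm)
    (isPiSystem_piiUnionInter _ (fun k => @MeasurableSpace.isPiSystem_measurableSet _
      (MeasurableSpace.comap k inferInstance)) 𝒦) ?_
    (huniv μ ν h)
  rintro S ⟨t, ht, F, hF, rfl⟩
  exact key t F ht hF μ ν h

end MulClosed

/-! ### Laplace functionals of random measures -/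

theorem measurable_lintegral_measure {α : Type*} [MeasurableSpace α] {g : α → ℝ≥0∞}
    (hg : Measurable g) : Measurable fun K : Measure α => ∫⁻ z, g z ∂K :=
  Measure.measurable_lintegral hg

/-- The functions `K ↦ e^{-∫ g dK}` generate the `σ`-algebra on the space of measures. -/
theorem measurable_of_expNeg_lintegral {Ω α : Type*} [MeasurableSpace α] {m : MeasurableSpace Ω}
    {X : Ω → Measure α}
    (h : ∀ g : α → ℝ≥0∞, Measurable g → Measurable fun ω => expNeg (∫⁻ z, g z ∂X ω)) :
    Measurable X := by
  refine Measure.measurable_of_measurable_coe _ fun A hA => ?_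
  have := measurable_negLog.comp (h (A.indicator 1) (measurable_one.indicator hA))
  simpa [Function.comp_def, lintegral_indicator_one hA] using this

/-- The law of a random measure is determined by its Laplace functional. -/
theorem ext_of_laplace {α : Type*} [MeasurableSpace α] {μ ν : Measure (Measure α)}
    [IsFiniteMeasure μ] [IsFiniteMeasure ν]
    (h : ∀ g : α → ℝ≥0∞, Measurable g →
      ∫⁻ K, expNeg (∫⁻ z, g z ∂K) ∂μ = ∫⁻ K, expNeg (∫⁻ z, g z ∂K) ∂ν) : μ = ν := by
  refine ext_of_mul_closed
    (𝒦 := {k | ∃ g : α → ℝ≥0∞, Measurable g ∧ k = fun K => expNeg (∫⁻ z, g z ∂K)}) ?_ ?_ ?_ ?_ ?_ ?_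
  · rintro _ ⟨g, -, rfl⟩ K
    exact expNeg_le_one _
  · exact ⟨0, measurable_zero, by simp⟩
  · rintro _ ⟨g, hg, rfl⟩ _ ⟨g', hg', rfl⟩
    refine ⟨g + g', hg.add hg', funext fun K => ?_⟩
    simp only [Pi.add_apply]
    rw [lintegral_add_left hg, expNeg_add]
  · rintro _ ⟨g, hg, rfl⟩
    exact measurable_expNeg.comp (measurable_lintegral_measure hg)
  · set m' : MeasurableSpace (Measure α) := ⨆ k ∈ {k | ∃ g : α → ℝ≥0∞, Measurable g ∧
      k = fun K : Measure α => expNeg (∫⁻ z, g z ∂K)}, MeasurableSpace.comap k inferInstance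
    -- Measurability of the identity from the generated σ-algebra to the given one is exactly the
    -- inclusion required.
    have : @Measurable _ _ m' Measure.instMeasurableSpace fun K : Measure α => K :=
      measurable_of_expNeg_lintegral (m := m') fun g hg =>
        Measurable.of_comap_le (le_iSup₂_of_le _ ⟨g, hg, rfl⟩ le_rfl)
    exact fun A hA => this hA
  · rintro _ ⟨g, hg, rfl⟩
    exact h g hg

/-! ### Stopped and shifted paths -/

theorem isCellPath_stopAt {w : ℝ≥0 → ℝ≥0} (hw : IsCellPath w) (a : ℝ≥0) :
    IsCellPath (fun r => w (min r a)) := by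
  have hR : ∀ t, a ≤ t → Tendsto (fun r => w (min r a)) (𝓝[>] t) (𝓝 (w a)) := fun t h =>
    tendsto_const_nhds.congr' (by
      filter_upwards [self_mem_nhdsWithin] with r hr
      rw [min_eq_right (h.trans (Set.mem_Ioi.1 hr).le)])
  have hL : ∀ t, a < t → (fun r => w (min r a)) =ᶠ[𝓝[<] t] fun _ => w a := fun t h => by
    filter_upwards [Ioo_mem_nhdsLT h] with r hr
    rw [min_eq_right hr.1.le]
  have hL' : ∀ t, t ≤ a → (fun r => w (min r a)) =ᶠ[𝓝[<] t] w := fun t h => by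
    filter_upwards [self_mem_nhdsWithin] with r hr
    rw [min_eq_left ((Set.mem_Iio.1 hr).le.trans h)]
  refine ⟨fun r t hrt h => hw.absorbed (min_le_min_right a hrt) h, fun t => ?_, fun t => ?_,
    fun t ht => ?_⟩
  · rcases lt_or_ge t a with h | h
    · simp only [min_eq_left h.le]
      refine (hw.right_cont t).congr' ?_
      filter_upwards [Ioo_mem_nhdsGT h] with r hr
      rw [min_eq_left hr.2.le]
    · simpa only [min_eq_right h] using hR t h
  · rcases le_or_gt t a with h | h
    · obtain ⟨l, hl⟩ := hw.left_lim t
      exact ⟨l, hl.congr' ((hL' t h).mono fun r hr => by simp only [hr])⟩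
    · exact ⟨w a, tendsto_const_nhds.congr' ((hL t h).mono fun r hr => by simp only [hr])⟩
  · rcases le_or_gt t a with h | h
    · simp only [min_eq_left h] at ht ⊢
      obtain ⟨l, hl, h'⟩ := hw.no_pos_jump t ht
      exact ⟨l, hl.congr' (hL' t h).symm, h'⟩
    · refine ⟨w a, tendsto_const_nhds.congr' (hL t h).symm, ?_⟩
      rw [min_eq_right h.le]

/-- The path stopped at time `a`. -/
def stopAt (a : ℝ≥0) (w : CellPath) : CellPath := ⟨fun r => w.1 (min r a), isCellPath_stopAt w.2 a⟩

theorem stopAt_apply_self (a : ℝ≥0) (w : CellPath) : (stopAt a w).1 a = w.1 a := by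
  simp [stopAt]

theorem measurable_eval_at (r : ℝ≥0) : Measurable fun w : CellPath => w.1 r :=
  (measurable_pi_apply r).comp measurable_subtype_coe

/-- Each coordinate of the stopped path is an evaluation at a time at most a. Events of the stopped
path are thus admissible in the Markov property. -/
theorem measurable_stopAt_past (a : ℝ≥0) : Measurable[past a] (stopAt a) := by
  refine Measurable.subtype_mk (h := fun w => isCellPath_stopAt w.2 a) ?_
  refine @measurable_pi_lambda _ _ _ (past a) _ _ fun r => ?_
  exact Measurable.of_comap_le (le_iSup₂_of_le (min r a) (min_le_right r a) le_rfl)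

theorem measurable_stopAt (a : ℝ≥0) : Measurable (stopAt a) :=
  Measurable.subtype_mk (h := fun w => isCellPath_stopAt w.2 a)
    (measurable_pi_lambda _ fun r => measurable_eval_at (min r a))

theorem measurable_shift (a : ℝ≥0) : Measurable (shift a) :=
  Measurable.subtype_mk (h := fun w => isCellPath_shift w.2 a)
    (measurable_pi_lambda _ fun r => measurable_eval_at (a + r))

theorem jumpSize_of_dead {w : CellPath} {r : ℝ≥0} (h : w.1 r = 0) : jumpSize w r = 0 := by
  simp [jumpSize, h]

theorem jumpSize_stopAt_of_le {a r : ℝ≥0} (h : r ≤ a) (w : CellPath) :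
    jumpSize (stopAt a w) r = jumpSize w r := by
  have hr : (stopAt a w).1 r = w.1 r := by simp [stopAt, min_eq_left h]
  by_cases hw : w.1 r = 0
  · rw [jumpSize_of_dead hw, jumpSize_of_dead (hr.trans hw)]
  by_cases h0 : r = 0
  · rw [h0, jumpSize_zero, jumpSize_zero]
  obtain ⟨l, hl, -⟩ := w.2.no_pos_jump r hw
  rw [jumpSize_eq h0 hw hl, jumpSize_eq h0 (hr ▸ hw) (l := l), hr]
  refine hl.congr' ?_
  filter_upwards [self_mem_nhdsWithin] with q hq
  simp [stopAt, min_eq_left ((Set.mem_Iio.1 hq).le.trans h)]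

theorem jumpSize_stopAt_of_lt {a r : ℝ≥0} (h : a < r) (w : CellPath) :
    jumpSize (stopAt a w) r = 0 := by
  have hr : (stopAt a w).1 r = w.1 a := by simp [stopAt, min_eq_right h.le]
  by_cases hw : w.1 a = 0
  · exact jumpSize_of_dead (hr.trans hw)
  rw [jumpSize_eq (pos_of_gt h).ne' (hr ▸ hw) (l := w.1 a), hr, tsub_self]
  refine tendsto_const_nhds.congr' ?_
  filter_upwards [Ioo_mem_nhdsLT h] with q hq
  simp [stopAt, min_eq_right hq.1.le]

/-- Time 0 is excluded because the shifted path has no left limit there: a jump at time a exactly is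
credited to the stopped path. -/
theorem jumpSize_shift {a r : ℝ≥0} (h0 : r ≠ 0) (w : CellPath) :
    jumpSize (shift a w) r = jumpSize w (a + r) := by
  by_cases hw : w.1 (a + r) = 0
  · rw [jumpSize_of_dead hw, jumpSize_of_dead (w := shift a w) hw]
  have h0' : a + r ≠ 0 := fun h => h0 (add_eq_zero.1 h).2
  obtain ⟨l, hl, -⟩ := w.2.no_pos_jump (a + r) hw
  rw [jumpSize_eq h0' hw hl, jumpSize_eq (w := shift a w) h0 hw (l := l)]
  · rfl
  · refine hl.comp (tendsto_nhdsWithin_iff.2 ⟨?_, ?_⟩)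
    · exact ((continuous_const.add continuous_id).tendsto r).mono_left nhdsWithin_le_nhds
    · filter_upwards [self_mem_nhdsWithin] with q hq
      exact add_lt_add_right (Set.mem_Iio.1 hq) a

/-! ### Sums over the jumps of a path -/

/-- The sum of `ψ(r, -ΔX(r))` over the jump times `r`, for `ψ` that vanishes at `∂`. -/
noncomputable def jumpSum (ψ : ℝ≥0 → ℝ≥0 → ℝ≥0∞) (w : CellPath) : ℝ≥0∞ :=
  ∑' r, ψ r (jumpSize w r)

/-- The sequence σ covers the support of g but may repeat itself; keeping only the first visit
counts every point once. An uncountable sum thus becomes a countable one. -/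
theorem tsum_eq_tsum_first_visits {α : Type*} (σ : ℕ → α) (g : α → ℝ≥0∞)
    (hg : ∀ r, g r ≠ 0 → ∃ n, σ n = r) [∀ n, Decidable (∃ m < n, σ m = σ n)] :
    ∑' r, g r = ∑' n, if ∃ m < n, σ m = σ n then 0 else g (σ n) := by
  classical
  let S : Set ℕ := {n | ¬∃ m < n, σ m = σ n}
  have hinj : Function.Injective fun n : S => σ n := by
    rintro ⟨n, hn⟩ ⟨n', hn'⟩ h
    rcases lt_trichotomy n n' with hlt | rfl | hlt
    · exact absurd ⟨n, hlt, h⟩ hn'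
    · rfl
    · exact absurd ⟨n', hlt, h.symm⟩ hn
  have hsupp : Function.support g ⊆ Set.range fun n : S => σ n := fun r hr => by
    have hex := hg r hr
    refine ⟨⟨Nat.find hex, ?_⟩, Nat.find_spec hex⟩
    rintro ⟨m, hm, h⟩
    exact Nat.find_min hex hm (h.trans (Nat.find_spec hex))
  rw [← hinj.tsum_eq hsupp, tsum_subtype S fun n => g (σ n)]
  refine tsum_congr fun n => ?_
  by_cases h : ∃ m < n, σ m = σ n
  · rw [if_pos h, Set.indicator_of_notMem (not_not.2 h)]
  · rw [if_neg h, Set.indicator_of_mem (show n ∈ S from h)]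

/-- By `exists_firstJump_eq` all jump times are among countably many measurable random times, so the
sum is a countable sum of measurable terms. The parameter γ serves the recursion for cumulants,
where the birth time varies. -/
theorem measurable_jumpSum {γ : Type*} [MeasurableSpace γ] {ψ : γ → ℝ≥0 → ℝ≥0 → ℝ≥0∞}
    (hψ : Measurable fun p : γ × ℝ≥0 × ℝ≥0 => ψ p.1 p.2.1 p.2.2) (h0 : ∀ c r, ψ c r 0 = 0) :
    Measurable fun p : γ × CellPath => jumpSum (ψ p.1) p.2 := by
  classical
  obtain ⟨e, he⟩ := exists_surjective_nat (ℚ≥0 × ℚ≥0 × ℚ≥0)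
  let σ : ℕ → CellPath → ℝ≥0 := fun n w =>
    (firstJump (e n).1 (e n).2.1 (e n).2.2 w).toNNReal
  have hσ : ∀ n, Measurable (σ n) := fun n => (measurable_firstJump _ _ _).ennreal_toNNReal
  have hsum : ∀ p : γ × CellPath, jumpSum (ψ p.1) p.2 =
      ∑' n, if ∃ m < n, σ m p.2 = σ n p.2 then 0 else
        ψ p.1 (σ n p.2) (jumpSize p.2 (σ n p.2)) := fun p => by
    refine tsum_eq_tsum_first_visits (fun n => σ n p.2)
      (fun r => ψ p.1 r (jumpSize p.2 r)) fun r hr => ?_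
    obtain ⟨a, b, c, h⟩ := exists_firstJump_eq p.2 (r := r) fun h => hr (by rw [h, h0])
    obtain ⟨n, hn⟩ := he (a, b, c)
    exact ⟨n, by simp only [σ, hn, h]⟩
  simp only [hsum]
  refine Measurable.tsum fun n => Measurable.ite ?_ measurable_const ?_
  · have : {p : γ × CellPath | ∃ m < n, σ m p.2 = σ n p.2} =
        ⋃ m, ⋃ _ : m < n, Prod.snd ⁻¹' {w | σ m w = σ n w} := by
      ext p; simp
    rw [this]
    exact .iUnion fun m => .iUnion fun _ => measurable_snd (measurableSet_eq_fun (hσ m) (hσ n))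
  · have h1 : Measurable fun p : γ × CellPath => σ n p.2 := (hσ n).comp measurable_snd
    exact hψ.comp (measurable_fst.prodMk
      (h1.prodMk (measurable_jumpSize.comp (measurable_snd.prodMk h1))))

theorem measurable_jumpSum' {ψ : ℝ≥0 → ℝ≥0 → ℝ≥0∞} (hψ : Measurable (Function.uncurry ψ))
    (h0 : ∀ r, ψ r 0 = 0) : Measurable (jumpSum ψ) :=
  (measurable_jumpSum (γ := Unit) (ψ := fun _ => ψ) (hψ.comp measurable_snd)
    fun _ => h0).comp (measurable_const (a := ()).prodMk measurable_id)

theorem jumpSum_mono {ψ ψ' : ℝ≥0 → ℝ≥0 → ℝ≥0∞} (h : ∀ r y, ψ r y ≤ ψ' r y) (w : CellPath) :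
    jumpSum ψ w ≤ jumpSum ψ' w :=
  ENNReal.tsum_le_tsum fun r => h r _

theorem jumpSum_iSup {ψ : ℕ → ℝ≥0 → ℝ≥0 → ℝ≥0∞} (h : Monotone ψ) (w : CellPath) :
    jumpSum (fun r y => ⨆ n, ψ n r y) w = ⨆ n, jumpSum (ψ n) w :=
  tsum_iSup_of_monotone (a := fun n r => ψ n r (jumpSize w r)) fun _ _ hmn r => h hmn r _

theorem jumpSum_stopAt {a : ℝ≥0} {ψ : ℝ≥0 → ℝ≥0 → ℝ≥0∞} (h0 : ∀ r, ψ r 0 = 0) (w : CellPath) :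
    jumpSum ψ (stopAt a w) = jumpSum (fun r y => if r ≤ a then ψ r y else 0) w := by
  refine tsum_congr fun r => ?_
  dsimp only
  split_ifs with h
  · rw [jumpSize_stopAt_of_le h]
  · rw [jumpSize_stopAt_of_lt (not_le.1 h), h0]

theorem jumpSum_shift {a : ℝ≥0} {ψ : ℝ≥0 → ℝ≥0 → ℝ≥0∞} (h0 : ∀ r, ψ r 0 = 0) (w : CellPath) :
    jumpSum (fun r y => ψ (a + r) y) (shift a w) =
      jumpSum (fun r y => if r ≤ a then 0 else ψ r y) w := by
  have hinj : Function.Injective fun r : ℝ≥0 => a + r := add_right_injective a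
  rw [jumpSum, jumpSum,
    ← hinj.tsum_eq (f := fun r => if r ≤ a then 0 else ψ r (jumpSize w r))]
  · refine tsum_congr fun r => ?_
    by_cases hr : r = 0
    · simp [hr, jumpSize_zero, h0]
    · rw [jumpSize_shift hr, if_neg]
      exact not_le.2 (lt_add_of_pos_right a (pos_iff_ne_zero.2 hr))
  · intro r hr
    have : a < r := by
      by_contra h
      exact hr (if_pos (not_lt.1 h))
    exact ⟨r - a, add_tsub_cancel_of_le this.le⟩

/-- The jumps up to time `a` and those after time `a`. -/
theorem jumpSum_split (a : ℝ≥0) {ψ : ℝ≥0 → ℝ≥0 → ℝ≥0∞} (h0 : ∀ r, ψ r 0 = 0) (w : CellPath) :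
    jumpSum ψ w = jumpSum ψ (stopAt a w) + jumpSum (fun r y => ψ (a + r) y) (shift a w) := by
  rw [jumpSum_stopAt h0, jumpSum_shift h0, jumpSum, jumpSum, jumpSum, ← ENNReal.tsum_add]
  refine tsum_congr fun r => ?_
  split_ifs <;> simp

/-! ### The list of the jump times -/

/-- Every jump of the path is preceded by finitely many jumps only. -/
def Listed (f : ℝ≥0 → ℝ≥0 → ℝ≥0) (w : CellPath) : Prop :=
  ∀ r, jumpSize w r ≠ 0 → {r' | Precedes f w r' r}.Finite

section Listed

variable {f : ℝ≥0 → ℝ≥0 → ℝ≥0} {w : CellPath}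

theorem Precedes.trans {r₁ r₂ r₃ : ℝ≥0} (h : Precedes f w r₁ r₂) (h' : Precedes f w r₂ r₃) :
    Precedes f w r₁ r₃ := by
  refine ⟨h.1, ?_⟩
  rcases h.2 with h1 | ⟨h1, h1'⟩ <;> rcases h'.2 with h2 | ⟨h2, h2'⟩
  · exact .inl (h2.trans h1)
  · exact .inl (h2 ▸ h1)
  · exact .inl (h1 ▸ h2)
  · exact .inr ⟨h1.trans h2, h1'.trans h2'⟩

theorem not_precedes_self (r : ℝ≥0) : ¬Precedes f w r r := by
  rintro ⟨-, h | ⟨-, h⟩⟩ <;> exact lt_irrefl _ h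

theorem precedes_or_precedes {r r' : ℝ≥0} (hr : jumpSize w r ≠ 0) (hr' : jumpSize w r' ≠ 0)
    (hne : r ≠ r') : Precedes f w r r' ∨ Precedes f w r' r := by
  rcases lt_trichotomy (f r (jumpSize w r)) (f r' (jumpSize w r')) with h | h | h
  · exact .inr ⟨hr', .inl h⟩
  · rcases lt_or_gt_of_ne hne with h' | h'
    · exact .inl ⟨hr, .inr ⟨h, h'⟩⟩
    · exact .inr ⟨hr', .inr ⟨h.symm, h'⟩⟩
  · exact .inl ⟨hr, .inl h⟩

/-- If r came first, its predecessors would form a proper subset of the finite set of predecessors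
of r', so the two ranks would differ. -/
theorem IsJumpOfRank.not_precedes {i : ℕ} {r r' : ℝ≥0} (h : IsJumpOfRank f w i r)
    (h' : IsJumpOfRank f w i r') : ¬Precedes f w r r' := fun hp => by
  have hfin : {q | Precedes f w q r'}.Finite := Set.finite_of_encard_eq_coe h'.2
  have hss : {q | Precedes f w q r} ⊂ {q | Precedes f w q r'} :=
    ⟨fun q hq => hq.trans hp, fun hsub => not_precedes_self r (hsub hp)⟩
  have := (hfin.subset hss.1).encard_lt_encard hss
  rw [h.2, h'.2] at this
  exact lt_irrefl _ this

theorem IsJumpOfRank.unique {i : ℕ} {r r' : ℝ≥0} (h : IsJumpOfRank f w i r)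
    (h' : IsJumpOfRank f w i r') : r = r' := by
  by_contra hne
  rcases precedes_or_precedes h.1 h'.1 hne with hp | hp
  · exact h.not_precedes h' hp
  · exact h'.not_precedes h hp

theorem IsJumpOfRank.jumpTime_eq {i : ℕ} {r : ℝ≥0} (h : IsJumpOfRank f w i r) :
    jumpTime f i w = r :=
  le_antisymm (iInf₂_le r h) (le_iInf₂ fun r' h' => by rw [h.unique h'])

theorem IsJumpOfRank.childSize_eq {i : ℕ} {r : ℝ≥0} (h : IsJumpOfRank f w i r) :
    childSize f i w = jumpSize w r := by
  rw [childSize, h.jumpTime_eq, if_neg ENNReal.coe_ne_top, ENNReal.toNNReal_coe]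

theorem childSize_eq_zero {i : ℕ} (h : ∀ r, ¬IsJumpOfRank f w i r) : childSize f i w = 0 := by
  rw [childSize, if_pos]
  simp [jumpTime, h]

/-- Ranks are finite and distinct, so they match the jumps with the indices in use; any other index
has a daughter of size ∂ and contributes 0. This is where the order of the listing drops out. -/
theorem Listed.tsum_children (hw : Listed f w) {ψ : ℝ≥0∞ → ℝ≥0 → ℝ≥0∞} (h0 : ∀ r, ψ r 0 = 0) :
    ∑' i, ψ (jumpTime f i w) (childSize f i w) = jumpSum (fun r y => ψ r y) w := by
  let S : Set ℝ≥0 := {r | jumpSize w r ≠ 0}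
  have hrank : ∀ r : S, ∃ i : ℕ, IsJumpOfRank f w i r := fun r =>
    ⟨_, r.2, (hw r r.2).encard_eq_coe⟩
  choose i hi using hrank
  have hinj : Function.Injective i := fun r r' h =>
    Subtype.ext ((hi r).unique (h ▸ hi r'))
  rw [← hinj.tsum_eq]
  · simp only [fun r => (hi r).jumpTime_eq, fun r => (hi r).childSize_eq]
    rw [jumpSum, tsum_subtype S fun r => ψ r (jumpSize w r)]
    refine tsum_congr fun r => ?_
    by_cases hr : jumpSize w r = 0
    · rw [Set.indicator_of_notMem (not_not.2 hr), hr, h0]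
    · rw [Set.indicator_of_mem (show r ∈ S from hr)]
  · intro j hj
    by_contra hno
    refine hj ?_
    dsimp only
    rw [childSize_eq_zero fun r hr => hno ⟨⟨r, hr.1⟩, ?_⟩, h0]
    have h1 := (hi ⟨r, hr.1⟩).2
    exact_mod_cast h1.symm.trans hr.2

end Listed

/-! ### Under [H] the ranking lists all jumps -/

theorem jumpSum_Iic (f : Gauge) (s t : ℝ≥0) (w : CellPath) :
    ∑' r : Set.Iic t, (f.toFun (s + r) (jumpSize w r) : ℝ≥0∞) =
      jumpSum (fun r y => if r ≤ t then (f.toFun (s + r) y : ℝ≥0∞) else 0) w := by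
  rw [jumpSum, tsum_subtype (Set.Iic t) fun r => (f.toFun (s + r) (jumpSize w r) : ℝ≥0∞)]
  exact tsum_congr fun r => by simp [Set.indicator_apply]

theorem Gauge.measurable_coe (f : Gauge) :
    Measurable fun p : ℝ≥0 × ℝ≥0 => (f.toFun p.1 p.2 : ℝ≥0∞) :=
  f.measurable.coe_nnreal_ennreal

theorem Gauge.pos (f : Gauge) {r x : ℝ≥0} (hx : x ≠ 0) : 0 < f.toFun r x := by
  have hx' : 0 < x := pos_iff_ne_zero.2 hx
  -- The inequalities in `inf_pos` are strict, hence a level below x and a horizon beyond r.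
  obtain ⟨c, hc, h⟩ := f.inf_pos (x / 2) (r + 1) (half_pos hx') (by positivity)
  exact hc.trans_le (h r x (lt_add_one r) (NNReal.half_lt_self hx))

/-- A convergent sum has finitely many terms above the positive number f(r, -ΔX(r)), and every
predecessor of r gives such a term. -/
theorem listed_of_jumpSum_ne_top (f : Gauge) {w : CellPath}
    (h : jumpSum (fun r y => (f.toFun r y : ℝ≥0∞)) w ≠ ∞) : Listed f.toFun w := fun r hr => by
  have hc : ((f.toFun r (jumpSize w r) : ℝ≥0) : ℝ≥0∞) ≠ 0 := by
    exact_mod_cast (f.pos hr).ne'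
  refine (ENNReal.finite_const_le_of_tsum_ne_top h hc).subset fun r' hr' => ?_
  rcases hr'.2 with h1 | ⟨h1, -⟩
  · exact ENNReal.coe_le_coe.2 h1.le
  · exact ENNReal.coe_le_coe.2 h1.ge

theorem ae_dead (X : CellProc) : ∀ᵐ w ∂X.law 0, ∀ r, w.1 r = 0 :=
  (X.start 0).mono fun w hw _ => w.2.absorbed zero_le hw

theorem jumpSum_of_dead {ψ : ℝ≥0 → ℝ≥0 → ℝ≥0∞} (h0 : ∀ r, ψ r 0 = 0) {w : CellPath}
    (hw : ∀ r, w.1 r = 0) : jumpSum ψ w = 0 := by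
  rw [jumpSum]
  simp [jumpSize_of_dead (hw _), h0]

/-- With s = 0, [H] bounds the expected f-weight of the jumps up to time n by f(0, x), uniformly in
n. By monotone convergence the total weight is integrable, hence almost surely finite. -/
theorem ae_listed {X : CellProc} {f : Gauge} (hH : X.HypH f) (x : ℝ≥0) :
    ∀ᵐ w ∂X.law x, Listed f.toFun w := by
  rcases eq_or_ne x 0 with rfl | hx
  · filter_upwards [ae_dead X] with w hw r hr
    exact absurd (jumpSize_of_dead (hw r)) hr
  let ψ : ℕ → ℝ≥0 → ℝ≥0 → ℝ≥0∞ := fun n r y => if r ≤ n then (f.toFun r y : ℝ≥0∞) else 0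
  have hψ0 : ∀ n r, ψ n r 0 = 0 := fun n r => by simp [ψ, f.cemetery]
  have hψm : ∀ n, Measurable (Function.uncurry (ψ n)) := fun n =>
    Measurable.ite (measurableSet_le measurable_fst measurable_const) f.measurable_coe
      measurable_const
  have hψmono : Monotone ψ := fun m n hmn r y => by
    simp only [ψ]
    split_ifs with h1 h2
    · exact le_rfl
    · exact absurd (h1.trans (Nat.cast_le.2 hmn)) h2
    · exact zero_le
    · exact le_rfl
  have hsup : (fun r y => (f.toFun r y : ℝ≥0∞)) = fun r y => ⨆ n, ψ n r y := by
    funext r y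
    obtain ⟨n, hn⟩ := exists_nat_ge r
    refine le_antisymm ((if_pos hn).ge.trans (le_iSup (fun n => ψ n r y) n)) (iSup_le fun n => ?_)
    simp only [ψ]
    split_ifs <;> simp
  have hbound : ∫⁻ w, jumpSum (fun r y => (f.toFun r y : ℝ≥0∞)) w ∂X.law x ≤ f.toFun 0 x := by
    simp only [hsup, jumpSum_iSup hψmono]
    rw [lintegral_iSup (fun n => measurable_jumpSum' (hψm n) (hψ0 n))
      fun m n h w => jumpSum_mono (fun r y => hψmono h r y) w]
    refine iSup_le fun n => ?_
    refine (lintegral_mono fun w => ?_).trans (hH x 0 n (pos_iff_ne_zero.2 hx))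
    refine le_add_left ?_
    rw [jumpSum_Iic]
    simp [ψ]
  have hm : Measurable (jumpSum fun r y => (f.toFun r y : ℝ≥0∞)) :=
    measurable_jumpSum' f.measurable_coe fun _ => by simp [f.cemetery]
  filter_upwards [ae_lt_top hm (hbound.trans_lt ENNReal.coe_lt_top).ne] with w hw
  exact listed_of_jumpSum_ne_top f hw.ne

/-! ### The Markov property -/

/-- The Markov property as a disintegration: on rectangles it is the defining identity, and
rectangles determine a finite measure on the product. The stopped path still shows the value at time
a, hence the kernel. -/
theorem map_stopAt_shift (X : CellProc) (x a : ℝ≥0) :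
    (X.law x).map (fun w => (stopAt a w, shift a w)) =
      (X.law x).map (stopAt a) ⊗ₘ X.law.comap (fun w : CellPath => w.1 a) (measurable_eval_at a) := by
  have hm : Measurable fun w => (stopAt a w, shift a w) :=
    (measurable_stopAt a).prodMk (measurable_shift a)
  have := Measure.isProbabilityMeasure_map (μ := X.law x) (measurable_stopAt a).aemeasurable
  have := Measure.isProbabilityMeasure_map (μ := X.law x) hm.aemeasurable
  refine Measure.ext_prod fun {S T} hS hT => ?_
  rw [Measure.map_apply hm (hS.prod hT), Measure.compProd_apply_prod hS hT,
    setLIntegral_map hS (Kernel.measurable_coe _ hT) (measurable_stopAt a)]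
  simp only [Kernel.comap_apply, stopAt_apply_self]
  exact X.markov x a (stopAt a ⁻¹' S) T (measurable_stopAt_past a hS) hT

/-- Conditionally on the path up to time a, the contribution of the later path may be replaced by
its cumulant from the current size. -/
theorem logMean_stopAt_shift (X : CellProc) (x a : ℝ≥0) {A B : CellPath → ℝ≥0∞} (hA : Measurable A)
    (hB : Measurable B) :
    logMean (X.law x) (fun w => A (stopAt a w) + B (shift a w)) =
      logMean (X.law x) (fun w => A (stopAt a w) + logMean (X.law (w.1 a)) B) := by
  have := Measure.isProbabilityMeasure_map (μ := X.law x) (measurable_stopAt a).aemeasurable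
  have hm : Measurable fun w => (stopAt a w, shift a w) :=
    (measurable_stopAt a).prodMk (measurable_shift a)
  have hA' : Measurable fun w => expNeg (A w) := measurable_expNeg.comp hA
  have hB' : Measurable fun w => expNeg (B w) := measurable_expNeg.comp hB
  have hF : Measurable fun p : CellPath × CellPath => expNeg (A p.1) * expNeg (B p.2) :=
    (hA'.comp measurable_fst).mul (hB'.comp measurable_snd)
  have hG : Measurable fun w : CellPath => expNeg (logMean (X.law (w.1 a)) B) :=
    measurable_expNeg.comp (measurable_logMean X.law (measurable_eval_at a)
      (ξ := fun _ => B) (hB.comp measurable_snd))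
  rw [logMean, logMean]
  congr 1
  simp only [expNeg_add]
  rw [← lintegral_map (f := fun p => expNeg (A p.1) * expNeg (B p.2)) hF hm, map_stopAt_shift,
    Measure.lintegral_compProd hF]
  simp only [Kernel.comap_apply]
  have hin : ∀ w : CellPath, ∫⁻ v, expNeg (A w) * expNeg (B v) ∂X.law (w.1 a) =
      expNeg (A w) * expNeg (logMean (X.law (w.1 a)) B) := fun w => by
    rw [lintegral_const_mul _ hB', expNeg_logMean]
  simp only [hin]
  rw [lintegral_map (f := fun w => expNeg (A w) * expNeg (logMean (X.law (w.1 a)) B))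
    (hA'.mul hG) (measurable_stopAt a)]
  simp only [stopAt_apply_self]

/-! ### Cumulants of the additive functionals of a cell system -/

/-- A measurable functional of the birth time and of the path of a cell that does not charge the
dead cells. -/
structure IsCellFunctional (φ : ℝ≥0∞ → CellPath → ℝ≥0∞) : Prop where
  measurable : Measurable (Function.uncurry φ)
  dead : ∀ b w, w.1 0 = 0 → φ b w = 0

theorem IsCellFunctional.add {φ φ' : ℝ≥0∞ → CellPath → ℝ≥0∞} (hφ : IsCellFunctional φ)
    (hφ' : IsCellFunctional φ') : IsCellFunctional fun b w => φ b w + φ' b w :=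
  ⟨hφ.measurable.add hφ'.measurable, fun b w hw => by simp [hφ.dead b w hw, hφ'.dead b w hw]⟩

theorem IsCellFunctional.measurable_right {φ : ℝ≥0∞ → CellPath → ℝ≥0∞} (hφ : IsCellFunctional φ)
    (b : ℝ≥0∞) : Measurable (φ b) :=
  hφ.measurable.comp measurable_prodMk_left

/-- The value at time `t` of a function `h` of the size. -/
noncomputable def obs (t : ℝ≥0) (h : ℝ≥0 → ℝ≥0∞) (b : ℝ≥0∞) (w : CellPath) : ℝ≥0∞ :=
  if b ≤ t then h (w.1 (t - b.toNNReal)) else 0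

theorem isCellFunctional_obs (t : ℝ≥0) {h : ℝ≥0 → ℝ≥0∞} (hm : Measurable h) (h0 : h 0 = 0) :
    IsCellFunctional (obs t h) := by
  refine ⟨?_, fun b w hw => ?_⟩
  · refine Measurable.ite (measurableSet_le measurable_fst measurable_const) ?_ measurable_const
    exact hm.comp (measurable_eval.comp (measurable_snd.prodMk
      (measurable_const.sub measurable_fst.ennreal_toNNReal)))
  · rw [obs, w.2.absorbed zero_le hw, h0, ite_self]

theorem obs_shift {s t : ℝ≥0} (hst : s ≤ t) (h : ℝ≥0 → ℝ≥0∞) (b : ℝ≥0∞) (w : CellPath) :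
    obs t h (s + b) w = obs (t - s) h b w := by
  induction b with
  | top => simp [obs]
  | coe b =>
    simp only [obs, ← ENNReal.coe_add, ENNReal.coe_le_coe, ENNReal.toNNReal_coe,
      tsub_add_eq_tsub_tsub, le_tsub_iff_left hst]

/-- The functional is a function of the path of the cell up to time `s`. -/
structure IsAdaptedTo (s : ℝ≥0) (φ : ℝ≥0∞ → CellPath → ℝ≥0∞) : Prop where
  after : ∀ b : ℝ≥0∞, s < b → ∀ w, φ b w = 0
  stopAt : ∀ b : ℝ≥0, b ≤ s → ∀ w, φ b (stopAt (s - b) w) = φ b w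

theorem isAdaptedTo_obs {r s : ℝ≥0} (hrs : r ≤ s) (g : ℝ≥0 → ℝ≥0∞) : IsAdaptedTo s (obs r g) := by
  refine ⟨fun b hb w => if_neg (not_le.2 (lt_of_le_of_lt (by exact_mod_cast hrs) hb)),
    fun b _ w => ?_⟩
  simp only [obs, stopAt, ENNReal.toNNReal_coe]
  rw [min_eq_left (tsub_le_tsub_right hrs b)]

section Cumulant

variable (X : CellProc)

/-- The cumulant `-log E[e^{-Φ}]` of the sum `Φ` of the values of `φ` at the cells of the first `n`
generations, for an ancestor of size `x` born at time `b`. -/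
noncomputable def cumulant (φ : ℝ≥0∞ → CellPath → ℝ≥0∞) : ℕ → ℝ≥0∞ → ℝ≥0 → ℝ≥0∞
  | 0, _, _ => 0
  | n + 1, b, x => logMean (X.law x) fun w =>
      φ b w + jumpSum (fun r y => cumulant φ n (b + r) y) w

/-- The cumulant of the sum over all the generations. -/
noncomputable def cumulantLim (φ : ℝ≥0∞ → CellPath → ℝ≥0∞) (b : ℝ≥0∞) (x : ℝ≥0) : ℝ≥0∞ :=
  ⨆ n, cumulant X φ n b x

variable {X} {φ : ℝ≥0∞ → CellPath → ℝ≥0∞}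

theorem cumulant_dead (hφ : IsCellFunctional φ) (n : ℕ) (b : ℝ≥0∞) : cumulant X φ n b 0 = 0 := by
  induction n generalizing b with
  | zero => rfl
  | succ n ih =>
    rw [cumulant, ← logMean_const (X.law 0) 0]
    refine logMean_congr ?_
    filter_upwards [ae_dead X] with w hw
    rw [hφ.dead b w (hw 0), jumpSum_of_dead (fun r => ih _) hw, add_zero]

theorem cumulantLim_dead (hφ : IsCellFunctional φ) (b : ℝ≥0∞) : cumulantLim X φ b 0 = 0 := by
  simp [cumulantLim, cumulant_dead hφ]

theorem measurable_cumulant (hφ : IsCellFunctional φ) (n : ℕ) :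
    Measurable (Function.uncurry (cumulant X φ n)) := by
  induction n with
  | zero => exact measurable_const
  | succ n ih =>
    have h1 : Measurable fun p : (ℝ≥0∞ × ℝ≥0) × CellPath =>
        jumpSum (fun r y => cumulant X φ n (p.1.1 + r) y) p.2 := by
      refine measurable_jumpSum (ψ := fun (c : ℝ≥0∞ × ℝ≥0) r y => cumulant X φ n (c.1 + r) y) ?_
        fun c r => cumulant_dead hφ n _
      exact ih.comp ((measurable_fst.fst.add
        measurable_snd.fst.coe_nnreal_ennreal).prodMk measurable_snd.snd)
    have h2 : Measurable fun p : (ℝ≥0∞ × ℝ≥0) × CellPath => φ p.1.1 p.2 :=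
      hφ.measurable.comp (measurable_fst.fst.prodMk measurable_snd)
    exact measurable_logMean X.law measurable_snd (h2.add h1)

theorem measurable_cumulantLim (hφ : IsCellFunctional φ) :
    Measurable (Function.uncurry (cumulantLim X φ)) :=
  Measurable.iSup fun n => measurable_cumulant hφ n

theorem measurable_cumulantLim_add (hφ : IsCellFunctional φ) (b : ℝ≥0∞) :
    Measurable (Function.uncurry fun (r y : ℝ≥0) => cumulantLim X φ (b + r) y) :=
  (measurable_cumulantLim hφ).comp
    ((measurable_const.add measurable_fst.coe_nnreal_ennreal).prodMk measurable_snd)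

theorem measurable_cumulant_add (hφ : IsCellFunctional φ) (n : ℕ) (b : ℝ≥0∞) :
    Measurable (Function.uncurry fun (r y : ℝ≥0) => cumulant X φ n (b + r) y) :=
  (measurable_cumulant hφ n).comp
    ((measurable_const.add measurable_fst.coe_nnreal_ennreal).prodMk measurable_snd)

theorem monotone_cumulant : Monotone (cumulant X φ) := by
  refine monotone_nat_of_le_succ fun n => ?_
  induction n with
  | zero => exact fun b x => zero_le
  | succ n ih =>
    exact fun b x => logMean_mono _ fun w => add_le_add_right (jumpSum_mono (fun r y => ih _ y) w) _

theorem cumulant_le_cumulantLim (n : ℕ) (b : ℝ≥0∞) (x : ℝ≥0) :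
    cumulant X φ n b x ≤ cumulantLim X φ b x :=
  le_iSup (fun n => cumulant X φ n b x) n

/-- Monotone limits pass through the sum over jumps and through the logarithmic mean, so the limit
is a fixed point of the recursion. -/
theorem cumulantLim_eq (hφ : IsCellFunctional φ) (b : ℝ≥0∞) (x : ℝ≥0) :
    cumulantLim X φ b x = logMean (X.law x) fun w =>
      φ b w + jumpSum (fun r y => cumulantLim X φ (b + r) y) w := by
  have hmono : Monotone fun n (r y : ℝ≥0) => cumulant X φ n (b + r) y := fun m n h r y =>
    monotone_cumulant h _ y
  have hmono' : Monotone fun n => cumulant X φ n b x := fun m n h => monotone_cumulant h b x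
  have h1 : cumulantLim X φ b x = ⨆ n, cumulant X φ (n + 1) b x :=
    (hmono'.iSup_nat_add 1).symm
  rw [h1]
  simp only [cumulant]
  rw [← logMean_iSup]
  · simp only [cumulantLim]
    congr 1
    funext w
    rw [← ENNReal.add_iSup, ← jumpSum_iSup hmono]
  · exact fun n => (hφ.measurable_right b).add
      (measurable_jumpSum' (measurable_cumulant_add hφ n b) fun r => cumulant_dead hφ n _)
  · exact fun m n h w => add_le_add_right (jumpSum_mono (fun r y => hmono h r y) w) _

/-- Descendants are born no earlier than their ancestor, so only the values of the functional at
birth times after s are ever used. -/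
theorem cumulant_congr {φ' : ℝ≥0∞ → CellPath → ℝ≥0∞} {s : ℝ≥0∞}
    (h : ∀ b, s < b → ∀ w, φ b w = φ' b w) (n : ℕ) {b : ℝ≥0∞} (hb : s < b) (x : ℝ≥0) :
    cumulant X φ n b x = cumulant X φ' n b x := by
  induction n generalizing b x with
  | zero => rfl
  | succ n ih =>
    simp only [cumulant]
    congr 1
    funext w
    rw [h b hb]
    congr 1
    exact tsum_congr fun r => ih (hb.trans_le le_self_add) _

theorem cumulantLim_congr {φ' : ℝ≥0∞ → CellPath → ℝ≥0∞} {s : ℝ≥0∞}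
    (h : ∀ b, s < b → ∀ w, φ b w = φ' b w) {b : ℝ≥0∞} (hb : s < b) (x : ℝ≥0) :
    cumulantLim X φ b x = cumulantLim X φ' b x :=
  iSup_congr fun n => cumulant_congr h n hb x

theorem cumulant_zero (n : ℕ) (b : ℝ≥0∞) (x : ℝ≥0) : cumulant X (fun _ _ => 0) n b x = 0 := by
  induction n generalizing b x with
  | zero => rfl
  | succ n ih => simp [cumulant, ih, jumpSum, logMean_const]

/-- Time homogeneity: the laws of the paths do not depend on the birth time, so only the time left
until the observation matters. -/
theorem cumulant_obs_shift {s t : ℝ≥0} (hst : s ≤ t) (h : ℝ≥0 → ℝ≥0∞) (n : ℕ) (b : ℝ≥0∞)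
    (x : ℝ≥0) : cumulant X (obs t h) n (s + b) x = cumulant X (obs (t - s) h) n b x := by
  induction n generalizing b x with
  | zero => rfl
  | succ n ih => simp only [cumulant, obs_shift hst, add_assoc, ih]

theorem cumulantLim_obs_shift {s t : ℝ≥0} (hst : s ≤ t) (h : ℝ≥0 → ℝ≥0∞) (b : ℝ≥0∞)
    (x : ℝ≥0) : cumulantLim X (obs t h) (s + b) x = cumulantLim X (obs (t - s) h) b x :=
  iSup_congr fun n => cumulant_obs_shift hst h n b x

variable (X φ) in
/-- The cumulant of the sum over the cells whose ancestor in generation `n`, if there is one, was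
born after time `s`. -/
noncomputable def hybrid (s : ℝ≥0) : ℕ → ℝ≥0∞ → ℝ≥0 → ℝ≥0∞
  | 0, b, x => if b ≤ s then 0 else cumulantLim X φ b x
  | n + 1, b, x => if b ≤ s then logMean (X.law x) fun w =>
      φ b w + jumpSum (fun r y => hybrid s n (b + r) y) w else cumulantLim X φ b x

theorem hybrid_of_lt {s : ℝ≥0} {b : ℝ≥0∞} (hb : s < b) (n : ℕ) (x : ℝ≥0) :
    hybrid X φ s n b x = cumulantLim X φ b x := by
  cases n <;> simp [hybrid, not_le.2 hb]

theorem cumulant_le_hybrid (s : ℝ≥0) (n : ℕ) (b : ℝ≥0∞) (x : ℝ≥0) :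
    cumulant X φ n b x ≤ hybrid X φ s n b x := by
  induction n generalizing b x with
  | zero => exact zero_le
  | succ n ih =>
    rcases le_or_gt b s with hb | hb
    · rw [hybrid, if_pos hb, cumulant]
      exact logMean_mono _ fun w => add_le_add_right (jumpSum_mono (fun r y => ih _ y) w) _
    · rw [hybrid_of_lt hb]
      exact cumulant_le_cumulantLim _ _ _

theorem hybrid_le_cumulantLim (hφ : IsCellFunctional φ) (s : ℝ≥0) (n : ℕ) (b : ℝ≥0∞) (x : ℝ≥0) :
    hybrid X φ s n b x ≤ cumulantLim X φ b x := by
  induction n generalizing b x with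
  | zero => rw [hybrid]; split_ifs <;> simp
  | succ n ih =>
    rcases le_or_gt b s with hb | hb
    · rw [hybrid, if_pos hb, cumulantLim_eq hφ]
      exact logMean_mono _ fun w => add_le_add_right (jumpSum_mono (fun r y => ih _ y) w) _
    · rw [hybrid_of_lt hb]

/-- Truncating all generations does not fit the cut at time s, since the posterity of a cell alive
at s restarts at generation 0. The hybrid truncates only along lines born by time s and keeps
families founded later entire. It lies between the truncated and the full cumulant, hence has the
same limit. -/
theorem iSup_hybrid (hφ : IsCellFunctional φ) (s : ℝ≥0) (b : ℝ≥0∞) (x : ℝ≥0) :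
    ⨆ n, hybrid X φ s n b x = cumulantLim X φ b x :=
  le_antisymm (iSup_le fun n => hybrid_le_cumulantLim hφ s n b x)
    (iSup_mono fun n => cumulant_le_hybrid s n b x)

theorem hybrid_dead (hφ : IsCellFunctional φ) (s : ℝ≥0) (n : ℕ) (b : ℝ≥0∞) :
    hybrid X φ s n b 0 = 0 :=
  le_antisymm ((hybrid_le_cumulantLim hφ s n b 0).trans (cumulantLim_dead hφ b).le) zero_le

variable {s t : ℝ≥0} {h : ℝ≥0 → ℝ≥0∞}

/-- Each path is cut at age s - b. Daughters born by time s are covered by the induction. Those born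
later, together with the cell's own value at time t, depend on the path after the cut alone and form
the integrand of the fixed-point equation for u; the Markov property replaces them by u of the size
at time s. -/
theorem hybrid_eq_cumulant (hφ : IsCellFunctional φ) (hφs : IsAdaptedTo s φ) (hst : s ≤ t)
    (hm : Measurable h) (h0 : h 0 = 0) (n : ℕ) {b : ℝ≥0} (hb : b ≤ s) (x : ℝ≥0) :
    hybrid X (fun b w => φ b w + obs t h b w) s n b x =
      cumulant X (fun b w => φ b w + obs s (cumulantLim X (obs (t - s) h) 0) b w) n b x := by
  set u : ℝ≥0 → ℝ≥0∞ := cumulantLim X (obs (t - s) h) 0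
  set Φ : ℝ≥0∞ → CellPath → ℝ≥0∞ := fun b w => φ b w + obs t h b w
  set Ψ : ℝ≥0∞ → CellPath → ℝ≥0∞ := fun b w => φ b w + obs s u b w
  have hO : IsCellFunctional (obs (t - s) h) := isCellFunctional_obs _ hm h0
  have hΦ : IsCellFunctional Φ := hφ.add (isCellFunctional_obs t hm h0)
  have hu : Measurable u := (measurable_cumulantLim hO).comp measurable_prodMk_left
  have hΨ : IsCellFunctional Ψ := hφ.add (isCellFunctional_obs s hu (cumulantLim_dead hO 0))
  have hlate : ∀ b : ℝ≥0∞, s < b → ∀ w, Ψ b w = 0 := fun b hb w => by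
    simp only [Ψ, hφs.after b hb, obs, if_neg (not_le.2 hb), add_zero]
  induction n generalizing b x with
  | zero => rw [hybrid, if_pos (by exact_mod_cast hb), cumulant]
  | succ n ih =>
    rw [hybrid, if_pos (by exact_mod_cast hb), cumulant]
    have hbs : b + (s - b) = s := add_tsub_cancel_of_le hb
    set a := s - b
    let H : ℝ≥0 → ℝ≥0 → ℝ≥0∞ := fun r y => hybrid X Φ s n (b + r) y
    let C : ℝ≥0 → ℝ≥0 → ℝ≥0∞ := fun r y => cumulant X Ψ n (b + r) y
    have hH0 : ∀ r, H r 0 = 0 := fun r => hybrid_dead hΦ s n _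
    have hC0 : ∀ r, C r 0 = 0 := fun r => cumulant_dead hΨ n _
    have hCH : ∀ w, jumpSum H (stopAt a w) = jumpSum C (stopAt a w) := fun w => by
      rw [jumpSum_stopAt hH0, jumpSum_stopAt hC0]
      congr 1
      funext r y
      split_ifs with hr
      · have hbr : b + r ≤ s := hbs ▸ add_le_add_right hr b
        simpa only [H, C, ENNReal.coe_add] using ih hbr y
      · rfl
    -- Families founded after time s contribute nothing here: both φ and the observation at time s
    -- vanish on them.
    have hCstopAt : ∀ w, jumpSum C w = jumpSum C (stopAt a w) := fun w => by
      rw [jumpSum_stopAt hC0]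
      congr 1
      funext r y
      split_ifs with hr
      · rfl
      · have hbr : (s : ℝ≥0∞) < b + r := by
          rw [← ENNReal.coe_add, ENNReal.coe_lt_coe, ← hbs]
          exact add_lt_add_right (not_le.1 hr) b
        simp only [C]
        rw [cumulant_congr (φ' := fun _ _ => 0) hlate n hbr, cumulant_zero]
    -- A daughter born strictly after time s has its entire family counted, φ no longer sees it, and
    -- time homogeneity moves the origin to s. At r = 0 the shifted path has no jump.
    have hHshift : ∀ w, jumpSum (fun r y => H (a + r) y) (shift a w) =
        jumpSum (fun r y => cumulantLim X (obs (t - s) h) (0 + r) y) (shift a w) := fun w => by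
      refine tsum_congr fun r => ?_
      by_cases hr : r = 0
      · simp only [hr, jumpSize_zero, hH0, cumulantLim_dead hO]
      have hbr : (b : ℝ≥0∞) + (a + r : ℝ≥0) = s + r := by
        rw [← ENNReal.coe_add, ← add_assoc, hbs, ENNReal.coe_add]
      have hsr : (s : ℝ≥0∞) < s + r := by
        exact_mod_cast lt_add_of_pos_right s (pos_iff_ne_zero.2 hr)
      simp only [H, hbr, zero_add]
      rw [hybrid_of_lt hsr, ← cumulantLim_obs_shift hst]
      refine cumulantLim_congr (fun b hb w => ?_) hsr _
      simp only [Φ, hφs.after b hb, zero_add]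
    have hobs : ∀ w, obs t h b w = obs (t - s) h 0 (shift a w) := fun w => by
      simp only [obs, shift, ENNReal.coe_le_coe, if_pos (hb.trans hst), zero_le, if_true,
        ENNReal.toNNReal_coe, ENNReal.toNNReal_zero, tsub_zero]
      refine congrArg h (congrArg w.1 ?_)
      rw [add_comm]
      exact (tsub_add_tsub_cancel hst hb).symm
    have hsplit : ∀ w, Φ b w + jumpSum H w = (φ b (stopAt a w) + jumpSum C (stopAt a w)) +
        (obs (t - s) h 0 (shift a w) +
          jumpSum (fun r y => cumulantLim X (obs (t - s) h) (0 + r) y) (shift a w)) := fun w => by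
      rw [jumpSum_split a hH0, hCH, hHshift, ← hobs, hφs.stopAt b hb]
      simp only [Φ]
      ring
    have hjoin : ∀ w, Ψ b w + jumpSum C w =
        (φ b (stopAt a w) + jumpSum C (stopAt a w)) + u (w.1 a) := fun w => by
      rw [hCstopAt, hφs.stopAt b hb]
      simp only [Ψ, obs, ENNReal.coe_le_coe, if_pos hb, ENNReal.toNNReal_coe]
      ring
    change logMean (X.law x) (fun w => Φ b w + jumpSum H w) =
      logMean (X.law x) (fun w => Ψ b w + jumpSum C w)
    simp only [hsplit, hjoin]
    rw [logMean_stopAt_shift X x a (A := fun w => φ b w + jumpSum C w)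
      (B := fun w => obs (t - s) h 0 w +
        jumpSum (fun r y => cumulantLim X (obs (t - s) h) (0 + r) y) w)]
    -- The inner logarithmic mean is the right side of the fixed-point equation for u at the size
    -- reached at time s.
    · simp only [← cumulantLim_eq hO]
      rfl
    · exact (hφ.measurable_right b).add (measurable_jumpSum' (measurable_cumulant_add hΨ n b) hC0)
    · exact (hO.measurable_right 0).add (measurable_jumpSum' (measurable_cumulantLim_add hO 0)
        fun r => cumulantLim_dead hO _)

/-- The branching property at time `s`, on the level of the cumulants. -/
theorem cumulantLim_branching (hφ : IsCellFunctional φ) (hφs : IsAdaptedTo s φ) (hst : s ≤ t)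
    (hm : Measurable h) (h0 : h 0 = 0) (x : ℝ≥0) :
    cumulantLim X (fun b w => φ b w + obs t h b w) 0 x =
      cumulantLim X (fun b w => φ b w + obs s (cumulantLim X (obs (t - s) h) 0) b w) 0 x := by
  rw [← iSup_hybrid (hφ.add (isCellFunctional_obs t hm h0)) s]
  exact iSup_congr fun n => hybrid_eq_cumulant hφ hφs hst hm h0 n zero_le x

end Cumulant

/-! ### The generations of a cell system -/

/-- The two constructions differ only in viewing generation 0 as a history indexed by a one-point
set. The second form gives the joint law of the generations up to m and the next one as a
composition product. -/
theorem systemLaw_eq_trajMeasure (X : CellProc) (f : Gauge) (x : ℝ≥0) :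
    X.systemLaw f x = Kernel.trajMeasure (X := Generation)
      ((X.law x).map fun w (_ : Fin 0 → ℕ) => w) (X.offspring f) := by
  have h : Measurable fun (w : CellPath) (_ : Fin 0 → ℕ) => w :=
    measurable_pi_lambda _ fun _ => measurable_id
  rw [CellProc.systemLaw, Kernel.comp_apply, Kernel.map_apply _ measurable_ancestor]
  refine congrArg (fun μ : Measure ((i : Finset.Iic 0) → Generation i) =>
    μ.bind (Kernel.traj (X := Generation) (X.offspring f) 0)) ?_
  refine Eq.trans ?_ (Measure.map_map (MeasurableEquiv.measurable _) h).symm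
  congr 1
  funext w i
  obtain ⟨i, hi⟩ := i
  obtain rfl : i = 0 := by simpa using hi
  rfl

/-- The dead path. -/
def deadPath : CellPath := ⟨fun _ => 0, fun _ _ _ _ => rfl, fun _ => tendsto_const_nhds,
  fun _ => ⟨0, tendsto_const_nhds⟩, fun _ h => absurd rfl h⟩

/-- The cell system with the given generations up to `m` and dead cells afterwards. -/
def extendSystem (m : ℕ) (h : (i : Finset.Iic m) → Generation i) : CellSystem := fun i =>
  if hi : i ≤ m then h ⟨i, Finset.mem_Iic.2 hi⟩ else fun _ => deadPath

theorem measurable_extendSystem (m : ℕ) : Measurable (extendSystem m) := by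
  refine measurable_pi_lambda _ fun i => ?_
  by_cases hi : i ≤ m
  · simp only [extendSystem, dif_pos hi]
    exact measurable_pi_apply _
  · simp only [extendSystem, dif_neg hi]
    exact measurable_const

theorem extendSystem_frestrictLe {m i : ℕ} (hi : i ≤ m) (C : CellSystem) :
    extendSystem m (Preorder.frestrictLe m C) i = C i := by
  simp [extendSystem, hi]

/-- Integration of a functional of the first `m + 1` generations: given the generations up to `m`,
the cells of the next one are independent. -/
theorem lintegral_next_generation (X : CellProc) (f : Gauge) (x : ℝ≥0) (m : ℕ)
    {F : CellSystem → Generation (m + 1) → ℝ≥0∞} (hF : Measurable (Function.uncurry F))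
    (hloc : ∀ C C' c, (∀ i ≤ m, C i = C' i) → F C c = F C' c) :
    ∫⁻ C, F C (C (m + 1)) ∂X.systemLaw f x =
      ∫⁻ C, ∫⁻ c, F C c ∂(Measure.infinitePi fun v : Fin (m + 1) → ℕ =>
        X.law (childSize f.toFun (v (Fin.last m)) (C m (Fin.init v)))) ∂X.systemLaw f x := by
  have hroot : Measurable fun (w : CellPath) (_ : Fin 0 → ℕ) => w :=
    measurable_pi_lambda _ fun _ => measurable_id
  have := Measure.isProbabilityMeasure_map (μ := X.law x) hroot.aemeasurable
  have hG : Measurable fun p : ((i : Finset.Iic m) → Generation i) × Generation (m + 1) =>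
      F (extendSystem m p.1) p.2 :=
    hF.comp (((measurable_extendSystem m).comp measurable_fst).prodMk measurable_snd)
  -- By locality the later generations may be filled with dead cells, so F becomes a function of the
  -- finite history to which the kernel applies.
  have hFG : ∀ C c, F C c = F (extendSystem m (Preorder.frestrictLe m C)) c := fun C c =>
    hloc _ _ c fun i hi => (extendSystem_frestrictLe hi C).symm
  have hr : Measurable (Preorder.frestrictLe (π := Generation) m) := by fun_prop
  have hpair : Measurable fun C : CellSystem => (Preorder.frestrictLe m C, C (m + 1)) :=
    hr.prodMk (measurable_pi_apply _)
  calc ∫⁻ C, F C (C (m + 1)) ∂X.systemLaw f x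
      = ∫⁻ C, F (extendSystem m (Preorder.frestrictLe m C)) (C (m + 1)) ∂X.systemLaw f x :=
        lintegral_congr fun C => hFG C _
    _ = ∫⁻ p, F (extendSystem m p.1) p.2
          ∂(X.systemLaw f x).map fun C => (Preorder.frestrictLe m C, C (m + 1)) :=
        (lintegral_map hG hpair).symm
    _ = ∫⁻ p, F (extendSystem m p.1) p.2
          ∂((X.systemLaw f x).map (Preorder.frestrictLe m) ⊗ₘ X.offspring f m) := by
        rw [systemLaw_eq_trajMeasure,
          Kernel.map_frestrictLe_trajMeasure_compProd_eq_map_trajMeasure]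
    _ = ∫⁻ C, ∫⁻ c, F (extendSystem m (Preorder.frestrictLe m C)) c
          ∂X.offspring f m (Preorder.frestrictLe m C) ∂X.systemLaw f x := by
        have := Measure.isProbabilityMeasure_map (μ := X.systemLaw f x) hr.aemeasurable
        rw [Measure.lintegral_compProd hG, lintegral_map (hG.lintegral_kernel_prod_right') hr]
    _ = _ := lintegral_congr fun C => lintegral_congr fun c => (hFG C c).symm

theorem lintegral_ancestor (X : CellProc) (f : Gauge) (x : ℝ≥0) {g : CellPath → ℝ≥0∞}
    (hg : Measurable g) (v : Fin 0 → ℕ) :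
    ∫⁻ C, g (C 0 v) ∂X.systemLaw f x = ∫⁻ w, g w ∂X.law x := by
  have hgC : Measurable fun C : CellSystem => g (C 0 v) :=
    hg.comp ((measurable_pi_apply v).comp (measurable_pi_apply 0))
  have hgh : Measurable fun h : (i : Finset.Iic 0) → Generation i =>
      g (h ⟨0, Finset.mem_Iic.2 le_rfl⟩ v) :=
    hg.comp ((measurable_pi_apply v).comp (measurable_pi_apply _))
  rw [CellProc.systemLaw, Kernel.lintegral_comp _ _ _ hgC, Kernel.map_apply _ measurable_ancestor,
    lintegral_map hgC.lintegral_kernel measurable_ancestor]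
  refine lintegral_congr fun w => ?_
  have h := Kernel.traj_map_frestrictLe_apply (κ := X.offspring f) 0 0 (ancestor w)
  rw [Kernel.partialTraj_self, Kernel.id_apply] at h
  have h2 := congrArg (fun μ => ∫⁻ h, g (h ⟨0, Finset.mem_Iic.2 le_rfl⟩ v) ∂μ) h
  rw [lintegral_map hgh (by fun_prop), lintegral_dirac' _ hgh] at h2
  exact h2

section Generations

variable (f : Gauge)

theorem birthTime_congr {C C' : CellSystem} (n : ℕ) (h : ∀ i < n, C i = C' i) (v : Fin n → ℕ) :
    birthTime f C n v = birthTime f C' n v := by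
  induction n with
  | zero => rfl
  | succ n ih =>
    rw [birthTime, birthTime, ih (fun i hi => h i (hi.trans n.lt_succ_self)), h n n.lt_succ_self]

theorem measurable_cell (n : ℕ) (v : Fin n → ℕ) : Measurable fun C : CellSystem => C n v :=
  (measurable_pi_apply v).comp (measurable_pi_apply n)

theorem measurable_birthTime (n : ℕ) (v : Fin n → ℕ) :
    Measurable fun C => birthTime f C n v := by
  induction n with
  | zero => exact measurable_const
  | succ n ih => exact (ih _).add ((measurable_jumpTime f.measurable _).comp (measurable_cell n _))

/-- The sum of `φ` over the cells of generation `n`. -/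
noncomputable def genSum (φ : ℝ≥0∞ → CellPath → ℝ≥0∞) (n : ℕ) (C : CellSystem) : ℝ≥0∞ :=
  ∑' v : Fin n → ℕ, φ (birthTime f C n v) (C n v)

/-- The sum of `ψ`, a function of the birth time and of the size at birth, over the cells of
generation `n + 1`. -/
noncomputable def newbornSum (ψ : ℝ≥0∞ → ℝ≥0 → ℝ≥0∞) (n : ℕ) (C : CellSystem) : ℝ≥0∞ :=
  ∑' v : Fin (n + 1) → ℕ,
    ψ (birthTime f C (n + 1) v) (childSize f.toFun (v (Fin.last n)) (C n (Fin.init v)))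

/-- The sum of `ψ` over the daughters of a cell born at time `b`. -/
noncomputable def childSum (ψ : ℝ≥0∞ → ℝ≥0 → ℝ≥0∞) (b : ℝ≥0∞) (w : CellPath) : ℝ≥0∞ :=
  ∑' i, ψ (b + jumpTime f.toFun i w) (childSize f.toFun i w)

theorem newbornSum_eq (ψ : ℝ≥0∞ → ℝ≥0 → ℝ≥0∞) (n : ℕ) (C : CellSystem) :
    newbornSum f ψ n C = genSum f (childSum f ψ) n C := by
  rw [newbornSum, ← (Fin.snocEquiv fun _ : Fin (n + 1) => ℕ).tsum_eq, ENNReal.tsum_prod',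
    ENNReal.tsum_comm, genSum]
  refine tsum_congr fun u => tsum_congr fun i => ?_
  simp [Fin.snocEquiv, birthTime]

theorem genSum_add (φ φ' : ℝ≥0∞ → CellPath → ℝ≥0∞) (n : ℕ) (C : CellSystem) :
    genSum f (fun b w => φ b w + φ' b w) n C = genSum f φ n C + genSum f φ' n C :=
  ENNReal.tsum_add

theorem genSum_congr (φ : ℝ≥0∞ → CellPath → ℝ≥0∞) {m n : ℕ} (hmn : m ≤ n) {C C' : CellSystem}
    (h : ∀ i ≤ n, C i = C' i) : genSum f φ m C = genSum f φ m C' :=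
  tsum_congr fun v => by
    rw [birthTime_congr f m (fun i hi => h i (hi.le.trans hmn)), h m hmn]

theorem measurable_genSum {φ : ℝ≥0∞ → CellPath → ℝ≥0∞} (hφ : Measurable (Function.uncurry φ))
    (n : ℕ) : Measurable (genSum f φ n) :=
  Measurable.tsum fun v => hφ.comp ((measurable_birthTime f n v).prodMk (measurable_cell n v))

theorem measurable_childSum {ψ : ℝ≥0∞ → ℝ≥0 → ℝ≥0∞} (hψ : Measurable (Function.uncurry ψ)) :
    Measurable (Function.uncurry (childSum f ψ)) :=
  Measurable.tsum fun i => hψ.comp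
    ((measurable_fst.add ((measurable_jumpTime f.measurable i).comp measurable_snd)).prodMk
      ((measurable_childSize f.measurable i).comp measurable_snd))

theorem measurable_sum_next {φ ξ : ℝ≥0∞ → CellPath → ℝ≥0∞} (hφ : Measurable (Function.uncurry φ))
    (hξ : Measurable (Function.uncurry ξ)) (m : ℕ) :
    Measurable (Function.uncurry fun (C : CellSystem) (c : Generation (m + 1)) =>
      ∑ k ∈ Finset.range (m + 1), genSum f φ k C +
        ∑' v, ξ (birthTime f C (m + 1) v) (c v)) := by
  refine Measurable.add ?_ (Measurable.tsum fun v => ?_)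
  · exact Finset.measurable_sum _ fun k _ => (measurable_genSum f hφ k).comp measurable_fst
  · exact hξ.comp (((measurable_birthTime f (m + 1) v).comp measurable_fst).prodMk
      ((measurable_pi_apply v).comp measurable_snd))

theorem sum_next_congr (φ ξ : ℝ≥0∞ → CellPath → ℝ≥0∞) (m : ℕ) {C C' : CellSystem}
    (c : Generation (m + 1)) (h : ∀ i ≤ m, C i = C' i) :
    ∑ k ∈ Finset.range (m + 1), genSum f φ k C + ∑' v, ξ (birthTime f C (m + 1) v) (c v) =
      ∑ k ∈ Finset.range (m + 1), genSum f φ k C' + ∑' v, ξ (birthTime f C' (m + 1) v) (c v) := by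
  congr 1
  · exact Finset.sum_congr rfl fun k hk =>
      genSum_congr f φ (Nat.lt_succ_iff.1 (Finset.mem_range.1 hk)) h
  · exact tsum_congr fun v => by rw [birthTime_congr f (m + 1) fun i hi => h i (Nat.lt_succ_iff.1 hi)]

/-- Newborns are grouped with their mothers, so each cell of generation m carries the integrand of
the one-step recursion. -/
theorem sum_genSum_succ (φ : ℝ≥0∞ → CellPath → ℝ≥0∞) (ψ : ℝ≥0∞ → ℝ≥0 → ℝ≥0∞) (m : ℕ)
    (C : CellSystem) :
    ∑ k ∈ Finset.range (m + 1), genSum f φ k C + newbornSum f ψ m C =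
      ∑ k ∈ Finset.range m, genSum f φ k C +
        ∑' v, (φ (birthTime f C m v) (C m v) + childSum f ψ (birthTime f C m v) (C m v)) := by
  rw [Finset.sum_range_succ, newbornSum_eq, add_assoc, ← genSum_add]
  rfl

variable {X : CellProc} {f}

/-- The cumulant of a functional of the first generations. -/
theorem logMean_systemLaw (hH : X.HypH f) {φ : ℝ≥0∞ → CellPath → ℝ≥0∞} (hφ : IsCellFunctional φ)
    (x : ℝ≥0) (m n : ℕ) :
    logMean (X.systemLaw f x) (fun C => ∑ k ∈ Finset.range (m + 1), genSum f φ k C +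
      newbornSum f (cumulant X φ n) m C) = cumulant X φ (n + m + 1) 0 x := by
  -- The recursion sums over jumps, the system over ranked daughters; the two agree almost surely
  -- because the ranking is exhaustive.
  have hstep : ∀ (n : ℕ) (b : ℝ≥0∞) (y : ℝ≥0), logMean (X.law y)
      (fun w => φ b w + childSum f (cumulant X φ n) b w) = cumulant X φ (n + 1) b y :=
    fun n b y => by
      refine logMean_congr ?_
      filter_upwards [ae_listed hH y] with w hw
      rw [childSum, hw.tsum_children (ψ := fun r y => cumulant X φ n (b + r) y)
        fun r => cumulant_dead hφ n _]
  have hξ : ∀ n, Measurable (Function.uncurry fun b w =>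
      φ b w + childSum f (cumulant X φ n) b w) := fun n =>
    hφ.measurable.add (measurable_childSum f (measurable_cumulant hφ n))
  induction m generalizing n with
  | zero =>
    rw [add_zero, ← hstep n 0 x]
    simp only [sum_genSum_succ]
    rw [logMean, logMean, ← lintegral_ancestor X f x
      (g := fun w => expNeg (φ 0 w + childSum f (cumulant X φ n) 0 w))
      (measurable_expNeg.comp ((hξ n).comp measurable_prodMk_left)) default]
    congr 1
    refine lintegral_congr fun C => ?_
    rw [Finset.sum_range_zero, zero_add, tsum_eq_single default fun v hv =>
      absurd (Subsingleton.elim v _) hv]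
    rfl
  | succ m ih =>
    -- Integrating out the last generation turns the cumulants of order n of its daughters into
    -- cumulants of order n + 1 of its own cells at birth; hence n stays general in the induction on
    -- m.
    rw [show n + (m + 1) + 1 = (n + 1) + m + 1 by ring, ← ih (n + 1), logMean, logMean]
    congr 1
    simp only [sum_genSum_succ f φ _ (m + 1)]
    refine (lintegral_next_generation X f x m (F := fun C c => expNeg
      (∑ k ∈ Finset.range (m + 1), genSum f φ k C + ∑' v, (φ (birthTime f C (m + 1) v) (c v) +
        childSum f (cumulant X φ n) (birthTime f C (m + 1) v) (c v))))
      (measurable_expNeg.comp (measurable_sum_next f hφ.measurable (hξ n) m))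
      fun C C' c h => congrArg expNeg (sum_next_congr f φ
        (fun b w => φ b w + childSum f (cumulant X φ n) b w) m c h)).trans ?_
    refine lintegral_congr fun C => ?_
    simp only [expNeg_add (∑ k ∈ Finset.range (m + 1), genSum f φ k C)]
    rw [lintegral_const_mul', ← expNeg_logMean, logMean_infinitePi
      (μ := fun v : Fin (m + 1) → ℕ =>
        X.law (childSize f.toFun (v (Fin.last m)) (C m (Fin.init v))))
      (ξ := fun v w => φ (birthTime f C (m + 1) v) w +
        childSum f (cumulant X φ n) (birthTime f C (m + 1) v) w)]
    · simp only [hstep]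
      rfl
    · exact fun v => (hξ n).comp measurable_prodMk_left
    · exact ((expNeg_le_one _).trans_lt ENNReal.one_lt_top).ne

/-- For n = 0 the newborns in `logMean_systemLaw` contribute nothing, which leaves the first m + 1
generations; then m tends to infinity monotonically. -/
theorem logMean_tsum_genSum (hH : X.HypH f) {φ : ℝ≥0∞ → CellPath → ℝ≥0∞}
    (hφ : IsCellFunctional φ) (x : ℝ≥0) :
    logMean (X.systemLaw f x) (fun C => ∑' k, genSum f φ k C) = cumulantLim X φ 0 x := by
  have hmono : Monotone fun n => cumulant X φ n 0 x := fun m n h => monotone_cumulant h 0 x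
  have hS : ∀ C, ∑' k, genSum f φ k C = ⨆ m, ∑ k ∈ Finset.range (m + 1), genSum f φ k C := fun C =>
    ENNReal.tsum_eq_iSup_nat' (tendsto_add_atTop_nat 1)
  simp only [hS]
  rw [logMean_iSup, cumulantLim, ← hmono.iSup_nat_add 1]
  · refine iSup_congr fun m => ?_
    have := logMean_systemLaw hH hφ x m 0
    simpa [newbornSum, cumulant] using this
  · exact fun m => Finset.measurable_sum _ fun k _ => measurable_genSum f hφ.measurable k
  · exact fun m n h C => Finset.sum_le_sum_of_subset (Finset.range_subset_range.2 (by omega))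

/-- A supermartingale in the generations. -/
theorem lintegral_systemLaw_le {φ : ℝ≥0∞ → CellPath → ℝ≥0∞} {ψ : ℝ≥0∞ → ℝ≥0 → ℝ≥0∞}
    (hφ : Measurable (Function.uncurry φ)) (hψ : Measurable (Function.uncurry ψ))
    (hstep : ∀ b y, ∫⁻ w, (φ b w + childSum f ψ b w) ∂X.law y ≤ ψ b y) (x : ℝ≥0) (m : ℕ) :
    ∫⁻ C, (∑ k ∈ Finset.range (m + 1), genSum f φ k C + newbornSum f ψ m C) ∂X.systemLaw f x ≤
      ψ 0 x := by
  have hξ : Measurable (Function.uncurry fun b w => φ b w + childSum f ψ b w) :=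
    hφ.add (measurable_childSum f hψ)
  induction m with
  | zero =>
    refine le_trans (le_of_eq ?_) (hstep 0 x)
    rw [← lintegral_ancestor X f x (g := fun w => φ 0 w + childSum f ψ 0 w)
      (hξ.comp measurable_prodMk_left) default]
    refine lintegral_congr fun C => ?_
    rw [sum_genSum_succ, Finset.sum_range_zero, zero_add, tsum_eq_single default fun v hv =>
      absurd (Subsingleton.elim v _) hv]
    rfl
  | succ m ih =>
    refine le_trans ?_ ih
    simp only [sum_genSum_succ f φ _ (m + 1)]
    refine (lintegral_next_generation X f x m (F := fun C c =>
      ∑ k ∈ Finset.range (m + 1), genSum f φ k C + ∑' v, (φ (birthTime f C (m + 1) v) (c v) +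
        childSum f ψ (birthTime f C (m + 1) v) (c v))) (measurable_sum_next f hφ hξ m)
      fun C C' c h => sum_next_congr f φ (fun b w => φ b w + childSum f ψ b w) m c h).trans_le ?_
    refine lintegral_mono fun C => ?_
    have hv : ∀ v : Fin (m + 1) → ℕ, Measurable fun w => φ (birthTime f C (m + 1) v) w +
        childSum f ψ (birthTime f C (m + 1) v) w := fun v => hξ.comp measurable_prodMk_left
    have hvc : ∀ v : Fin (m + 1) → ℕ, Measurable fun c : (Fin (m + 1) → ℕ) → CellPath =>
        φ (birthTime f C (m + 1) v) (c v) + childSum f ψ (birthTime f C (m + 1) v) (c v) :=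
      fun v => (hv v).comp (measurable_pi_apply v)
    dsimp only
    rw [lintegral_add_left measurable_const, lintegral_const, measure_univ, mul_one,
      lintegral_tsum fun v => (hvc v).aemeasurable]
    -- Expectations are linear, so only the marginal law of each cell matters and independence plays
    -- no role.
    refine add_le_add_right (ENNReal.tsum_le_tsum fun v => ?_) _
    refine le_trans (le_of_eq ?_) (hstep _ _)
    exact lintegral_eval_infinitePi (μ := fun v : Fin (m + 1) → ℕ =>
      X.law (childSize f.toFun (v (Fin.last m)) (C m (Fin.init v)))) v
      (g := fun w => φ (birthTime f C (m + 1) v) w + childSum f ψ (birthTime f C (m + 1) v) w) (hv v)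

theorem lintegral_atom {h : ℝ≥0 → ℝ≥0∞} (h0 : h 0 = 0) (y : ℝ≥0) : ∫⁻ z, h z ∂atom y = h y := by
  rw [atom]
  split_ifs with hy
  · simp [hy, h0]
  · rw [lintegral_dirac]

theorem lintegral_growthFrag {h : ℝ≥0 → ℝ≥0∞} (h0 : h 0 = 0) (t : ℝ≥0) (C : CellSystem) :
    ∫⁻ z, h z ∂growthFrag f t C = ∑' k, genSum f (obs t h) k C := by
  rw [growthFrag, lintegral_sum_measure, ENNReal.tsum_sigma']
  refine tsum_congr fun k => tsum_congr fun v => ?_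
  rw [obs]
  split_ifs
  · rw [lintegral_atom h0]
  · rw [lintegral_zero_measure]

theorem measurable_atom : Measurable atom :=
  Measurable.ite (measurableSet_singleton 0) measurable_const Measure.measurable_dirac

theorem measurable_growthFrag (t : ℝ≥0) : Measurable (growthFrag f t) := by
  refine Measure.measurable_of_measurable_coe _ fun A hA => ?_
  simp only [growthFrag, Measure.sum_apply _ hA]
  refine Measurable.tsum fun u => (Measure.measurable_coe hA).comp (Measurable.ite ?_ ?_
    measurable_const)
  · exact measurableSet_le (measurable_birthTime f u.1 u.2) measurable_const
  · exact measurable_atom.comp (measurable_eval.comp ((measurable_cell u.1 u.2).prodMk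
      (measurable_const.sub (measurable_birthTime f u.1 u.2).ennreal_toNNReal)))

/-- The weight of the population is a supermartingale. -/
theorem lintegral_growthFrag_le (hH : X.HypH f) (s t x : ℝ≥0) :
    ∫⁻ C, ∫⁻ z, (f.toFun (s + t) z : ℝ≥0∞) ∂growthFrag f t C ∂X.systemLaw f x ≤
      f.toFun s x := by
  let h : ℝ≥0 → ℝ≥0∞ := fun z => f.toFun (s + t) z
  have h0 : h 0 = 0 := by simp [h, f.cemetery]
  have hm : Measurable h := f.measurable_coe.comp measurable_prodMk_left
  have hφ := isCellFunctional_obs t hm h0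
  -- The weight of a cell at its birth, discarded if it is born after time t. With this choice the
  -- one-step inequality is [H] at time s + b over the remaining time t - b.
  let ψ : ℝ≥0∞ → ℝ≥0 → ℝ≥0∞ := fun b y => if b ≤ t then f.toFun (s + b.toNNReal) y else 0
  have hψ : Measurable (Function.uncurry ψ) :=
    Measurable.ite (measurableSet_le measurable_fst measurable_const)
      (f.measurable_coe.comp ((measurable_const.add measurable_fst.ennreal_toNNReal).prodMk
        measurable_snd)) measurable_const
  have hψ0 : ∀ b, ψ b 0 = 0 := fun b => by simp [ψ, f.cemetery]
  have hstep : ∀ b y, ∫⁻ w, (obs t h b w + childSum f ψ b w) ∂X.law y ≤ ψ b y := fun b y => by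
    have hlist : ∀ᵐ w ∂X.law y, obs t h b w + childSum f ψ b w =
        obs t h b w + jumpSum (fun r y => ψ (b + r) y) w := by
      filter_upwards [ae_listed hH y] with w hw
      rw [childSum, hw.tsum_children (ψ := fun r y => ψ (b + r) y) fun r => hψ0 _]
    rw [lintegral_congr_ae hlist]
    rcases le_or_gt b t with hb | hb
    · lift b to ℝ≥0 using ne_top_of_le_ne_top ENNReal.coe_ne_top hb
      rw [ENNReal.coe_le_coe] at hb
      rcases eq_or_ne y 0 with rfl | hy
      · refine le_of_eq_of_le ?_ zero_le
        rw [← lintegral_zero (μ := X.law 0)]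
        refine lintegral_congr_ae ?_
        filter_upwards [ae_dead X] with w hw
        rw [hφ.dead _ _ (hw 0), jumpSum_of_dead (fun r => hψ0 _) hw, add_zero]
      · refine le_of_eq_of_le (lintegral_congr fun w => ?_)
          ((hH y (s + b) (t - b) (pos_iff_ne_zero.2 hy)).trans_eq ?_)
        · rw [jumpSum_Iic]
          congr 1
          · simp [obs, h, hb, add_assoc]
          · congr 1
            funext r y
            simp only [ψ, ← ENNReal.coe_add, ENNReal.coe_le_coe, ENNReal.toNNReal_coe,
              le_tsub_iff_left hb, add_assoc]
        · simp [ψ, hb]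
    · refine le_of_eq_of_le ?_ zero_le
      have : ∀ r : ℝ≥0, ¬b + r ≤ t := fun r => not_le.2 (hb.trans_le le_self_add)
      simp [obs, jumpSum, ψ, not_le.2 hb, this]
  have hmain : ∫⁻ C, ∫⁻ z, h z ∂growthFrag f t C ∂X.systemLaw f x ≤ ψ 0 x := by
    simp only [lintegral_growthFrag h0]
    have hS : ∀ C, ∑' k, genSum f (obs t h) k C =
        ⨆ m, ∑ k ∈ Finset.range (m + 1), genSum f (obs t h) k C := fun C =>
      ENNReal.tsum_eq_iSup_nat' (tendsto_add_atTop_nat 1)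
    simp only [hS]
    rw [lintegral_iSup]
    -- The weight of the newborns of the next generation is nonnegative and may be dropped.
    · exact iSup_le fun m => (lintegral_mono fun C => le_self_add).trans
        (lintegral_systemLaw_le hφ.measurable hψ hstep x m)
    · exact fun m => Finset.measurable_sum _ fun k _ => measurable_genSum f hφ.measurable k
    · exact fun m n hmn C => Finset.sum_le_sum_of_subset (Finset.range_subset_range.2 (by omega))
  simpa [ψ] using hmain

end Generations

/-! ### Multisets as point measures -/

/-- Unused indices are filled with ∂, which does not count. -/
theorem exists_ofSeq_eq {ι : Type*} [Countable ι] (y : ι → ℝ≥0) :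
    ∃ y', Measure.sum (fun i => atom (y i)) = ofSeq y' := by
  obtain ⟨e, he⟩ := exists_injective_nat ι
  refine ⟨Function.extend e y 0, Measure.ext fun A hA => ?_⟩
  rw [ofSeq, Measure.sum_apply _ hA, Measure.sum_apply _ hA, ← he.tsum_eq]
  · simp only [he.extend_apply]
  · intro n hn
    by_contra h
    refine hn ?_
    dsimp only
    rw [Function.extend_apply' _ _ _ fun ⟨i, hi⟩ => h ⟨i, hi⟩]
    simp [atom]

theorem exists_ofSeq_eq_growthFrag (f : Gauge) (t : ℝ≥0) (C : CellSystem) :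
    ∃ y, growthFrag f t C = ofSeq y := by
  obtain ⟨y, hy⟩ := exists_ofSeq_eq fun u : (n : ℕ) × (Fin n → ℕ) =>
    if birthTime f C u.1 u.2 ≤ t then (C u.1 u.2).1 (t - (birthTime f C u.1 u.2).toNNReal) else 0
  refine ⟨y, hy ▸ ?_⟩
  rw [growthFrag]
  congr 1
  funext u
  split_ifs <;> simp [atom]

theorem exists_ofSeq_eq_sum {J : ℕ → Measure ℝ≥0} (h : ∀ i, ∃ y, J i = ofSeq y) :
    ∃ y, Measure.sum J = ofSeq y := by
  choose y hy using h
  obtain ⟨y', hy'⟩ := exists_ofSeq_eq fun p : ℕ × ℕ => y p.1 p.2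
  refine ⟨y', hy' ▸ Measure.ext fun A hA => ?_⟩
  simp only [hy, ofSeq, Measure.sum_apply _ hA, ENNReal.tsum_prod']

theorem lintegral_ofSeq {h : ℝ≥0 → ℝ≥0∞} (h0 : h 0 = 0) (y : ℕ → ℝ≥0) :
    ∫⁻ z, h z ∂ofSeq y = ∑' i, h (y i) := by
  rw [ofSeq, lintegral_sum_measure]
  exact tsum_congr fun i => lintegral_atom h0 (y i)

/-- The function `g` on `(0, ∞)`, extended by `0` at `∂`. -/
noncomputable def killed (g : ℝ≥0 → ℝ≥0∞) (z : ℝ≥0) : ℝ≥0∞ := if z = 0 then 0 else g z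

theorem killed_zero (g : ℝ≥0 → ℝ≥0∞) : killed g 0 = 0 := if_pos rfl

theorem measurable_killed {g : ℝ≥0 → ℝ≥0∞} (hg : Measurable g) : Measurable (killed g) :=
  Measurable.ite (measurableSet_singleton 0) measurable_const hg

/-- These point measures do not charge ∂, so test functions may be assumed to vanish there, as cell
functionals require. -/
theorem lintegral_killed (g : ℝ≥0 → ℝ≥0∞) {J : Measure ℝ≥0} (hJ : ∃ y, J = ofSeq y) :
    ∫⁻ z, killed g z ∂J = ∫⁻ z, g z ∂J := by
  obtain ⟨y, rfl⟩ := hJ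
  simp only [ofSeq, lintegral_sum_measure]
  refine tsum_congr fun i => ?_
  rw [atom]
  split_ifs with h
  · simp
  · rw [lintegral_dirac, lintegral_dirac, killed, if_neg h]

theorem ofSeq_apply (y : ℕ → ℝ≥0) {A : Set ℝ≥0} (hA : MeasurableSet A) (h0 : 0 ∉ A) :
    ofSeq y A = {i | y i ∈ A}.encard := by
  classical
  rw [← ENNReal.tsum_set_one, tsum_subtype {i | y i ∈ A} fun _ => (1 : ℝ≥0∞), ofSeq,
    Measure.sum_apply _ hA]
  refine tsum_congr fun i => ?_
  rw [atom]
  split_ifs with h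
  · simp [h, h0]
  · simp [Measure.dirac_apply' _ hA, Set.indicator_apply]

theorem ofSeq_singleton_zero (y : ℕ → ℝ≥0) : ofSeq y {0} = 0 := by
  rw [ofSeq, Measure.sum_apply _ (measurableSet_singleton 0), ENNReal.tsum_eq_zero]
  intro i
  rw [atom]
  split_ifs with h
  · rfl
  · rw [Measure.dirac_apply' _ (measurableSet_singleton 0), Set.indicator_of_notMem]
    simpa using h

/-! ### Multisets determined by their tail counts, and their decreasing enumeration -/

theorem measure_Ioi_eq_iSup (J : Measure ℝ≥0) (p : ℝ≥0) :
    J (Set.Ioi p) = ⨆ q : {q : ℚ≥0 // p < q}, J (Set.Ioi (q.1 : ℝ≥0)) := by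
  have : Set.Ioi p = ⋃ q : {q : ℚ≥0 // p < q}, Set.Ioi (q.1 : ℝ≥0) := by
    ext z
    simp only [Set.mem_Ioi, Set.mem_iUnion, Subtype.exists, exists_prop]
    exact ⟨fun h => exists_nnrat_btwn h, fun ⟨q, h1, h2⟩ => h1.trans h2⟩
  rw [this]
  refine Directed.measure_iUnion fun q q' => ?_
  refine ⟨⟨min q.1 q'.1, ?_⟩, ?_, ?_⟩
  · rcases min_choice q.1 q'.1 with h | h <;> rw [h]
    exacts [q.2, q'.2]
  · exact Set.Ioi_subset_Ioi (by exact_mod_cast min_le_left _ _)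
  · exact Set.Ioi_subset_Ioi (by exact_mod_cast min_le_right _ _)

/-- The measures may be infinite near 0, so uniqueness on the π-system of half-lines is applied on
each (q, ∞), and countably many of these cover the complement of 0. -/
theorem measure_ext_of_Ioi {J K : Measure ℝ≥0} (hJ0 : J {0} = 0) (hK0 : K {0} = 0)
    (hfin : ∀ q : ℚ≥0, 0 < q → J (Set.Ioi (q : ℝ≥0)) ≠ ∞)
    (h : ∀ q : ℚ≥0, 0 < q → J (Set.Ioi (q : ℝ≥0)) = K (Set.Ioi (q : ℝ≥0))) : J = K := by
  have hpos : ∀ p : ℝ≥0, 0 < p → J (Set.Ioi p) = K (Set.Ioi p) := fun p hp => by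
    rw [measure_Ioi_eq_iSup, measure_Ioi_eq_iSup]
    exact iSup_congr fun q => h q.1 (by exact_mod_cast hp.trans q.2)
  have hres : ∀ q : ℚ≥0, 0 < q →
      J.restrict (Set.Ioi (q : ℝ≥0)) = K.restrict (Set.Ioi (q : ℝ≥0)) := fun q hq => by
    have : IsFiniteMeasure (J.restrict (Set.Ioi (q : ℝ≥0))) :=
      isFiniteMeasure_restrict.2 (hfin q hq)
    refine ext_of_generate_finite _ (borel_eq_generateFrom_Ioi ℝ≥0 ▸ BorelSpace.measurable_eq)
      isPiSystem_Ioi ?_ ?_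
    · rintro _ ⟨a, rfl⟩
      rw [Measure.restrict_apply measurableSet_Ioi, Measure.restrict_apply measurableSet_Ioi,
        Set.Ioi_inter_Ioi]
      exact hpos _ (lt_max_of_lt_right (by exact_mod_cast hq))
    · rw [Measure.restrict_apply_univ, Measure.restrict_apply_univ, h q hq]
  have hIoi : J.restrict (⋃ q : {q : ℚ≥0 // 0 < q}, Set.Ioi (q.1 : ℝ≥0)) =
      K.restrict (⋃ q : {q : ℚ≥0 // 0 < q}, Set.Ioi (q.1 : ℝ≥0)) :=
    Measure.restrict_iUnion_congr.2 fun q => hres q.1 q.2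
  have hcov : (⋃ q : {q : ℚ≥0 // 0 < q}, Set.Ioi (q.1 : ℝ≥0)) = {0}ᶜ := by
    ext z
    simp only [Set.mem_iUnion, Set.mem_Ioi, Subtype.exists, exists_prop, Set.mem_compl_iff,
      Set.mem_singleton_iff]
    constructor
    · rintro ⟨q, -, h⟩
      exact (pos_of_gt h).ne'
    · intro hz
      obtain ⟨q, h1, h2⟩ := exists_nnrat_btwn (pos_iff_ne_zero.2 hz)
      exact ⟨q, by exact_mod_cast h1, h2⟩
  rw [hcov] at hIoi
  rw [← Measure.restrict_add_restrict_compl (μ := J) (measurableSet_singleton (0 : ℝ≥0)),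
    ← Measure.restrict_add_restrict_compl (μ := K) (measurableSet_singleton (0 : ℝ≥0)), hIoi,
    Measure.restrict_eq_zero.2 hJ0, Measure.restrict_eq_zero.2 hK0]

/-- A point measure on `(0, ∞)` with finitely many points in `(a, ∞)` for every `a > 0`. -/
def IsLocallyFiniteMultiset (J : Measure ℝ≥0) : Prop :=
  J {0} = 0 ∧ ∀ q : ℚ≥0, 0 < q → ∃ n : ℕ, J (Set.Ioi (q : ℝ≥0)) = n

theorem measurableSet_isLocallyFiniteMultiset :
    MeasurableSet {J : Measure ℝ≥0 | IsLocallyFiniteMultiset J} := by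
  refine MeasurableSet.inter ?_ ?_
  · exact Measure.measurable_coe (measurableSet_singleton 0) (measurableSet_singleton 0)
  · have : {J : Measure ℝ≥0 | ∀ q : ℚ≥0, 0 < q → ∃ n : ℕ, J (Set.Ioi (q : ℝ≥0)) = n} =
        ⋂ q : {q : ℚ≥0 // 0 < q}, ⋃ n : ℕ,
          (fun J : Measure ℝ≥0 => J (Set.Ioi (q.1 : ℝ≥0))) ⁻¹' {(n : ℝ≥0∞)} := by
      ext J; simp
    change MeasurableSet {J : Measure ℝ≥0 | ∀ q : ℚ≥0, 0 < q → ∃ n : ℕ, J (Set.Ioi (q : ℝ≥0)) = n}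
    rw [this]
    exact .iInter fun q => .iUnion fun n =>
      Measure.measurable_coe measurableSet_Ioi (measurableSet_singleton _)

/-- The points of a multiset in decreasing order. -/
noncomputable def ranked (J : Measure ℝ≥0) (i : ℕ) : ℝ≥0 :=
  (⨆ q : ℚ≥0, if (i : ℝ≥0∞) < J (Set.Ioi (q : ℝ≥0)) then ((q : ℝ≥0) : ℝ≥0∞) else 0).toNNReal

theorem measurable_ranked : Measurable ranked := by
  refine measurable_pi_lambda _ fun i => (Measurable.iSup fun q => ?_).ennreal_toNNReal
  exact Measurable.ite (measurableSet_lt measurable_const (Measure.measurable_coe measurableSet_Ioi))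
    measurable_const measurable_const

/-- The point of index i exceeds q exactly when more than i points do. Finiteness of the tail counts
makes the supremum in `ranked` finite, so that its conversion to a real number loses nothing. -/
theorem IsLocallyFiniteMultiset.lt_ranked_iff {J : Measure ℝ≥0} (hJ : IsLocallyFiniteMultiset J)
    {q : ℚ≥0} (i : ℕ) : (q : ℝ≥0) < ranked J i ↔ (i : ℝ≥0∞) < J (Set.Ioi (q : ℝ≥0)) := by
  constructor
  · intro h
    have h' : ((q : ℝ≥0) : ℝ≥0∞) < _ :=
      (ENNReal.coe_lt_coe.2 h).trans_le ENNReal.coe_toNNReal_le_self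
    obtain ⟨q', hq'⟩ := lt_iSup_iff.1 h'
    split_ifs at hq' with hi
    · exact hi.trans_le (measure_mono (Set.Ioi_subset_Ioi (ENNReal.coe_le_coe.1 hq'.le)))
    · exact absurd hq' not_lt_zero
  · intro h
    have hlim : Tendsto (fun n : ℕ => J (Set.Ioi ((n : ℝ≥0) + 1))) atTop (𝓝 0) := by
      have hint : ⋂ n : ℕ, Set.Ioi ((n : ℝ≥0) + 1) = ∅ := by
        refine Set.eq_empty_of_forall_notMem fun z hz => ?_
        obtain ⟨n, hn⟩ := exists_nat_ge z
        have := Set.mem_iInter.1 hz n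
        exact absurd (this.trans_le hn) (not_lt.2 le_self_add)
      have := tendsto_measure_iInter_atTop (μ := J) (s := fun n : ℕ => Set.Ioi ((n : ℝ≥0) + 1))
        (fun n => measurableSet_Ioi.nullMeasurableSet)
        (fun m n hmn => Set.Ioi_subset_Ioi (by gcongr)) ⟨0, ?_⟩
      · rwa [hint, measure_empty] at this
      · obtain ⟨n, hn⟩ := hJ.2 1 one_pos
        simp only [Nat.cast_zero, zero_add]
        rw [show (1 : ℝ≥0) = ((1 : ℚ≥0) : ℝ≥0) by simp, hn]
        exact ENNReal.natCast_ne_top n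
    -- Tail counts are integers and tend to 0, so one of them vanishes: the multiset is bounded.
    obtain ⟨N, hN⟩ := (hlim.eventually_lt_const one_pos).exists
    have hN0 : J (Set.Ioi ((N : ℝ≥0) + 1)) = 0 := by
      obtain ⟨n, hn⟩ := hJ.2 (N + 1) (by positivity)
      have hcast : (((N + 1 : ℚ≥0)) : ℝ≥0) = N + 1 := by push_cast; rfl
      rw [hcast] at hn
      rw [hn] at hN ⊢
      have : n < 1 := by exact_mod_cast hN
      simp [Nat.lt_one_iff.1 this]
    have htop : (⨆ q : ℚ≥0, if (i : ℝ≥0∞) < J (Set.Ioi (q : ℝ≥0)) then ((q : ℝ≥0) : ℝ≥0∞) else 0) ≠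
        ∞ := by
      refine ne_top_of_le_ne_top (b := (((N : ℝ≥0) + 1 : ℝ≥0) : ℝ≥0∞)) ENNReal.coe_ne_top
        (iSup_le fun q => ?_)
      split_ifs with hi
      · refine ENNReal.coe_le_coe.2 (le_of_not_gt fun hq => ?_)
        exact absurd (hi.trans_le ((measure_mono (Set.Ioi_subset_Ioi hq.le)).trans hN0.le))
          not_lt_zero
      · exact zero_le
    -- Continuity from below supplies a rational q' > q with the same property, which gives the
    -- strict inequality.
    rw [measure_Ioi_eq_iSup, lt_iSup_iff] at h
    obtain ⟨⟨q', hqq'⟩, hq'⟩ := h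
    rw [ranked, ← ENNReal.coe_lt_coe, ENNReal.coe_toNNReal htop]
    refine (ENNReal.coe_lt_coe.2 hqq').trans_le (le_iSup_of_le q' ?_)
    rw [if_pos hq']

/-- If n points lie above q, the indices whose ranked point exceeds q are exactly those below n, so
all tail counts agree. -/
theorem IsLocallyFiniteMultiset.eq_ofSeq {J : Measure ℝ≥0} (hJ : IsLocallyFiniteMultiset J) :
    J = ofSeq (ranked J) := by
  refine measure_ext_of_Ioi hJ.1 (ofSeq_singleton_zero _) (fun q hq => ?_) fun q hq => ?_
  · obtain ⟨n, hn⟩ := hJ.2 q hq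
    exact hn ▸ ENNReal.natCast_ne_top n
  · obtain ⟨n, hn⟩ := hJ.2 q hq
    rw [ofSeq_apply _ measurableSet_Ioi (by simp)]
    have : {i | ranked J i ∈ Set.Ioi (q : ℝ≥0)} = ↑(Finset.range n) := by
      ext i
      simp only [Set.mem_Ioi, Set.mem_ofPred_eq, hJ.lt_ranked_iff, hn, Nat.cast_lt, Finset.coe_range,
        Set.mem_Iio]
    rw [this, Set.encard_coe_eq_coe_finsetCard, Finset.card_range, hn]
    simp

/-- A Markov inequality: above the level q the weight f(s, ·) is at least a constant c > 0, so a
finite total weight allows finitely many points there. -/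
theorem Gauge.isLocallyFiniteMultiset (f : Gauge) {s : ℝ≥0} {J : Measure ℝ≥0}
    (hJ : J ∈ f.multisets s) : IsLocallyFiniteMultiset J := by
  obtain ⟨⟨y, rfl⟩, hfin⟩ := hJ
  refine ⟨ofSeq_singleton_zero y, fun q hq => ?_⟩
  obtain ⟨c, hc, h⟩ := f.inf_pos q (s + 1) (by exact_mod_cast hq) (by positivity)
  have hlt : ofSeq y (Set.Ioi (q : ℝ≥0)) < ∞ := by
    have h1 : (c : ℝ≥0∞) * ofSeq y (Set.Ioi (q : ℝ≥0)) ≤ ∫⁻ z, (f.toFun s z : ℝ≥0∞) ∂ofSeq y := by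
      rw [← setLIntegral_const]
      refine (setLIntegral_mono' measurableSet_Ioi fun z hz => ?_).trans
        (setLIntegral_le_lintegral _ _)
      exact ENNReal.coe_le_coe.2 (h s z (lt_add_one s) hz)
    by_contra htop
    rw [not_lt_top_iff.1 htop, ENNReal.mul_top (by exact_mod_cast hc.ne')] at h1
    exact absurd (h1.trans_lt hfin) (lt_irrefl _)
  rw [ofSeq_apply _ measurableSet_Ioi (by simp)] at hlt ⊢
  have hf : {i | y i ∈ Set.Ioi (q : ℝ≥0)}.Finite := by
    by_contra hinf
    rw [Set.Infinite.encard_eq hinf] at hlt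
    simp at hlt
  exact ⟨hf.toFinset.card, by rw [hf.encard_eq_coe_toFinset_card]; rfl⟩

/-- The existence of an enumeration is not visibly a measurable condition. For finite weight it
amounts to countably many conditions on tail counts. -/
theorem Gauge.measurableSet_multisets (f : Gauge) (s : ℝ≥0) : MeasurableSet (f.multisets s) := by
  have hm : Measurable fun z => (f.toFun s z : ℝ≥0∞) := f.measurable_coe.comp measurable_prodMk_left
  have : f.multisets s = {J | IsLocallyFiniteMultiset J} ∩
      {J | ∫⁻ z, (f.toFun s z : ℝ≥0∞) ∂J < ∞} := by
    ext J
    exact ⟨fun hJ => ⟨f.isLocallyFiniteMultiset hJ, hJ.2⟩, fun hJ => ⟨⟨_, hJ.1.eq_ofSeq⟩, hJ.2⟩⟩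
  rw [this]
  exact measurableSet_isLocallyFiniteMultiset.inter
    (measurableSet_lt (measurable_lintegral_measure hm) measurable_const)

/-! ### The transition kernel -/

section BranchLaw

variable {X : CellProc} {f : Gauge}

theorem measurable_sum_growthFrag (f : Gauge) (t : ℝ≥0) :
    Measurable fun C : ℕ → CellSystem => Measure.sum fun i => growthFrag f t (C i) := by
  refine Measure.measurable_of_measurable_coe _ fun A hA => ?_
  simp only [Measure.sum_apply _ hA]
  exact Measurable.tsum fun i => (Measure.measurable_coe hA).comp
    ((measurable_growthFrag t).comp (measurable_pi_apply i))

instance isProbabilityMeasure_branchLaw (t : ℝ≥0) (y : ℕ → ℝ≥0) :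
    IsProbabilityMeasure (X.branchLaw f t y) :=
  Measure.isProbabilityMeasure_map (measurable_sum_growthFrag f t).aemeasurable

theorem measurable_branchLaw (t : ℝ≥0) : Measurable (X.branchLaw f t) :=
  (Measure.measurable_map _ (measurable_sum_growthFrag f t)).comp
    (measurable_infinitePi fun i => (X.systemLaw f).comap (fun y : ℕ → ℝ≥0 => y i)
      (measurable_pi_apply i))

theorem logMean_growthFrag (hH : X.HypH f) {h : ℝ≥0 → ℝ≥0∞} (hm : Measurable h) (h0 : h 0 = 0)
    (t x : ℝ≥0) :
    logMean (X.systemLaw f x) (fun C => ∫⁻ z, h z ∂growthFrag f t C) =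
      cumulantLim X (obs t h) 0 x := by
  simp only [lintegral_growthFrag h0]
  exact logMean_tsum_genSum hH (isCellFunctional_obs t hm h0) x

/-- The Laplace functional of `ρ`. -/
theorem logMean_branchLaw (hH : X.HypH f) {g : ℝ≥0 → ℝ≥0∞} (hg : Measurable g) (t : ℝ≥0)
    (y : ℕ → ℝ≥0) :
    logMean (X.branchLaw f t y) (fun K => ∫⁻ z, g z ∂K) =
      ∫⁻ z, cumulantLim X (obs t (killed g)) 0 z ∂ofSeq y := by
  have hm := measurable_killed hg
  have h0 := killed_zero g
  rw [lintegral_ofSeq (cumulantLim_dead (isCellFunctional_obs t hm h0) 0),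
    CellProc.branchLaw, logMean_map (measurable_sum_growthFrag f t)
      (measurable_lintegral_measure hg)]
  simp only [lintegral_sum_measure, ← logMean_growthFrag hH hm h0,
    lintegral_killed g (exists_ofSeq_eq_growthFrag f t _)]
  exact logMean_infinitePi (μ := fun i => X.systemLaw f (y i))
    (ξ := fun _ C => ∫⁻ z, g z ∂growthFrag f t C)
    fun _ => (measurable_lintegral_measure hg).comp (measurable_growthFrag t)

/-- The Laplace functional sees the enumeration only through the point measure. Hence the choice
made in `rho` is immaterial, and the measurable enumeration `ranked` may replace it. -/
theorem branchLaw_congr (hH : X.HypH f) (t : ℝ≥0) {y y' : ℕ → ℝ≥0} (h : ofSeq y = ofSeq y') :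
    X.branchLaw f t y = X.branchLaw f t y' := by
  refine ext_of_laplace fun g hg => ?_
  rw [← expNeg_logMean, ← expNeg_logMean, logMean_branchLaw hH hg, logMean_branchLaw hH hg, h]

theorem rho_ofSeq (hH : X.HypH f) (s t : ℝ≥0) (y : ℕ → ℝ≥0) :
    X.rho f s t (ofSeq y) = X.branchLaw f (t - s) y := by
  have h : ∃ y', ofSeq y = ofSeq y' := ⟨y, rfl⟩
  rw [CellProc.rho, dif_pos h]
  exact branchLaw_congr hH _ h.choose_spec.symm

theorem rho_eq_branchLaw_ranked (hH : X.HypH f) (s t : ℝ≥0) {J : Measure ℝ≥0}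
    (hJ : J ∈ f.multisets s) : X.rho f s t J = X.branchLaw f (t - s) (ranked J) := by
  conv_lhs => rw [(f.isLocallyFiniteMultiset hJ).eq_ofSeq]
  exact rho_ofSeq hH s t _

/-- The supermartingale bound, summed over the members of the multiset, makes the expected weight at
time t finite. -/
theorem ae_mem_multisets_branchLaw (hH : X.HypH f) {s t : ℝ≥0} (hst : s ≤ t) {y : ℕ → ℝ≥0}
    (hy : ofSeq y ∈ f.multisets s) :
    ∀ᵐ K ∂X.branchLaw f (t - s) y, K ∈ f.multisets t := by
  have hm : Measurable fun z => (f.toFun t z : ℝ≥0∞) := f.measurable_coe.comp measurable_prodMk_left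
  have hmC : Measurable fun C => ∫⁻ z, (f.toFun t z : ℝ≥0∞) ∂growthFrag f (t - s) C :=
    (measurable_lintegral_measure hm).comp (measurable_growthFrag (t - s))
  have hmi : ∀ i : ℕ, Measurable fun C : ℕ → CellSystem =>
      ∫⁻ z, (f.toFun t z : ℝ≥0∞) ∂growthFrag f (t - s) (C i) := fun i =>
    hmC.comp (measurable_pi_apply i)
  refine (ae_map_iff (measurable_sum_growthFrag f _).aemeasurable
    (f.measurableSet_multisets t)).2 ?_
  have hle : ∫⁻ C, ∑' i, ∫⁻ z, (f.toFun t z : ℝ≥0∞) ∂growthFrag f (t - s) (C i)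
      ∂(Measure.infinitePi fun i => X.systemLaw f (y i)) < ∞ := by
    rw [lintegral_tsum fun i => (hmi i).aemeasurable]
    refine lt_of_le_of_lt (ENNReal.tsum_le_tsum fun i => ?_)
      ((lintegral_ofSeq (h := fun z => (f.toFun s z : ℝ≥0∞)) (by simp [f.cemetery]) y) ▸ hy.2)
    rw [lintegral_eval_infinitePi (μ := fun i => X.systemLaw f (y i)) i hmC]
    simpa only [add_tsub_cancel_of_le hst] using lintegral_growthFrag_le hH s (t - s) (y i)
  filter_upwards [ae_lt_top (Measurable.tsum hmi) hle.ne] with C hC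
  refine ⟨exists_ofSeq_eq_sum fun i => exists_ofSeq_eq_growthFrag f _ (C i), ?_⟩
  rwa [lintegral_sum_measure]

theorem ae_mem_multisets_growthFrag (hH : X.HypH f) (s x : ℝ≥0) :
    ∀ᵐ C ∂X.systemLaw f x, growthFrag f s C ∈ f.multisets s := by
  have hm : Measurable fun z => (f.toFun s z : ℝ≥0∞) := f.measurable_coe.comp measurable_prodMk_left
  have hmC : Measurable fun C => ∫⁻ z, (f.toFun s z : ℝ≥0∞) ∂growthFrag f s C :=
    (measurable_lintegral_measure hm).comp (measurable_growthFrag s)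
  have hle : ∫⁻ C, ∫⁻ z, (f.toFun s z : ℝ≥0∞) ∂growthFrag f s C ∂X.systemLaw f x < ∞ := by
    have := lintegral_growthFrag_le hH 0 s x
    rw [zero_add] at this
    exact this.trans_lt ENNReal.coe_lt_top
  filter_upwards [ae_lt_top hmC hle.ne] with C hC
  exact ⟨exists_ofSeq_eq_growthFrag f s C, hC⟩

end BranchLaw

/-! ### The conditional law of the growth-fragmentation -/

section ConditionalLaw

variable {X : CellProc} {f : Gauge}

theorem history_le (f : Gauge) (s : ℝ≥0) : history f s ≤ MeasurableSpace.pi :=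
  iSup₂_le fun r _ => (measurable_growthFrag r).comap_le

theorem measurable_growthFrag_history (f : Gauge) {r s : ℝ≥0} (h : r ≤ s) :
    Measurable[history f s] (growthFrag f r) :=
  Measurable.of_comap_le (le_iSup₂_of_le r h le_rfl)

/-- The exponentials of the functionals of the past are determined by the history. -/
def historyClass (f : Gauge) (s : ℝ≥0) : Set (CellSystem → ℝ≥0∞) :=
  {k | ∃ φ, IsCellFunctional φ ∧ IsAdaptedTo s φ ∧
    Measurable[history f s] (fun C => ∑' n, genSum f φ n C) ∧
    k = fun C => expNeg (∑' n, genSum f φ n C)}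

theorem one_mem_historyClass (f : Gauge) (s : ℝ≥0) : (fun _ => 1) ∈ historyClass f s :=
  ⟨fun _ _ => 0, ⟨measurable_const, fun _ _ _ => rfl⟩, ⟨fun _ _ _ => rfl, fun _ _ _ => rfl⟩,
    by simp [genSum], by simp [genSum]⟩

theorem mul_mem_historyClass {s : ℝ≥0} {k l : CellSystem → ℝ≥0∞} (hk : k ∈ historyClass f s)
    (hl : l ∈ historyClass f s) : (fun C => k C * l C) ∈ historyClass f s := by
  obtain ⟨φ, hφ, hφs, hm, rfl⟩ := hk
  obtain ⟨φ', hφ', hφs', hm', rfl⟩ := hl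
  refine ⟨fun b w => φ b w + φ' b w, hφ.add hφ', ⟨fun b hb w => ?_, fun b hb w => ?_⟩, ?_, ?_⟩
  · rw [hφs.after b hb, hφs'.after b hb, add_zero]
  · rw [hφs.stopAt b hb, hφs'.stopAt b hb]
  · simp only [genSum_add, ENNReal.tsum_add]
    exact hm.add hm'
  · simp only [genSum_add, ENNReal.tsum_add, expNeg_add]

theorem expNeg_lintegral_mem_historyClass (f : Gauge) {r s : ℝ≥0} (hrs : r ≤ s)
    {g : ℝ≥0 → ℝ≥0∞} (hg : Measurable g) :
    (fun C => expNeg (∫⁻ z, g z ∂growthFrag f r C)) ∈ historyClass f s := by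
  have hC : ∀ C, ∫⁻ z, g z ∂growthFrag f r C = ∑' n, genSum f (obs r (killed g)) n C := fun C => by
    rw [← lintegral_killed g (exists_ofSeq_eq_growthFrag f r C),
      lintegral_growthFrag (killed_zero g)]
  refine ⟨obs r (killed g), isCellFunctional_obs r (measurable_killed hg) (killed_zero g),
    isAdaptedTo_obs hrs _, ?_, funext fun C => by rw [hC]⟩
  simp only [← hC]
  exact (measurable_lintegral_measure hg).comp (measurable_growthFrag_history f hrs)

theorem measurable_of_mem_historyClass {s : ℝ≥0} {k : CellSystem → ℝ≥0∞}
    (hk : k ∈ historyClass f s) : Measurable[history f s] k := by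
  obtain ⟨φ, -, -, hm, rfl⟩ := hk
  exact measurable_expNeg.comp hm

theorem le_one_of_mem_historyClass {s : ℝ≥0} {k : CellSystem → ℝ≥0∞}
    (hk : k ∈ historyClass f s) (C : CellSystem) : k C ≤ 1 := by
  obtain ⟨φ, -, -, -, rfl⟩ := hk
  exact expNeg_le_one _

theorem history_le_iSup_historyClass (f : Gauge) (s : ℝ≥0) :
    history f s ≤ ⨆ k ∈ historyClass f s, MeasurableSpace.comap k inferInstance := by
  refine iSup₂_le fun r hr => Measurable.comap_le ?_
  exact measurable_of_expNeg_lintegral fun g hg => Measurable.of_comap_le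
    (le_iSup₂_of_le _ (expNeg_lintegral_mem_historyClass f hr hg) le_rfl)

variable (X f) in
/-- The law of the population after a time `r`, given that it has been `𝐗(s)`. -/
noncomputable def nextLaw (s r : ℝ≥0) : Kernel CellSystem (Measure ℝ≥0) where
  toFun C := X.branchLaw f r (ranked (growthFrag f s C))
  measurable' := (measurable_branchLaw r).comp (measurable_ranked.comp (measurable_growthFrag s))

instance (s r : ℝ≥0) : IsMarkovKernel (nextLaw X f s r) :=
  ⟨fun C => isProbabilityMeasure_branchLaw r (ranked (growthFrag f s C))⟩

theorem ae_rho_eq_nextLaw (hH : X.HypH f) (s t x : ℝ≥0) :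
    ∀ᵐ C ∂X.systemLaw f x, X.rho f s t (growthFrag f s C) = nextLaw X f s (t - s) C := by
  filter_upwards [ae_mem_multisets_growthFrag hH s x] with C hC
  exact rho_eq_branchLaw_ranked hH s t hC

theorem measurable_nextLaw_apply (s r : ℝ≥0) {B : Set (Measure ℝ≥0)} (hB : MeasurableSet B) :
    Measurable[history f s] fun C => nextLaw X f s r C B :=
  (Measure.measurable_coe hB).comp ((measurable_branchLaw r).comp
    (measurable_ranked.comp (measurable_growthFrag_history f le_rfl)))

/-- The branching property on the level of Laplace functionals. -/
theorem lintegral_mul_expNeg_growthFrag (hH : X.HypH f) {s t : ℝ≥0} (hst : s ≤ t) (x : ℝ≥0)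
    {k : CellSystem → ℝ≥0∞} (hk : k ∈ historyClass f s) {g : ℝ≥0 → ℝ≥0∞} (hg : Measurable g) :
    ∫⁻ C, k C * expNeg (∫⁻ z, g z ∂growthFrag f t C) ∂X.systemLaw f x =
      ∫⁻ C, k C * ∫⁻ K, expNeg (∫⁻ z, g z ∂K) ∂nextLaw X f s (t - s) C ∂X.systemLaw f x := by
  obtain ⟨φ, hφ, hφs, -, rfl⟩ := hk
  have hm := measurable_killed hg
  have h0 := killed_zero g
  have hO := isCellFunctional_obs (t - s) hm h0
  set u : ℝ≥0 → ℝ≥0∞ := cumulantLim X (obs (t - s) (killed g)) 0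
  have hu : Measurable u := (measurable_cumulantLim hO).comp measurable_prodMk_left
  have hu0 : u 0 = 0 := cumulantLim_dead hO 0
  have hL : ∀ C, expNeg (∑' n, genSum f φ n C) * expNeg (∫⁻ z, g z ∂growthFrag f t C) =
      expNeg (∑' n, genSum f (fun b w => φ b w + obs t (killed g) b w) n C) := fun C => by
    simp only [genSum_add, ENNReal.tsum_add, expNeg_add]
    rw [← lintegral_killed g (exists_ofSeq_eq_growthFrag f t C), lintegral_growthFrag h0]
  -- Given 𝐗(s), the Laplace functional of the next population is e^{-∫ u d𝐗(s)}. This holds almost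
  -- surely only, since recovering 𝐗(s) from its ranked points needs local finiteness.
  have hR : ∀ᵐ C ∂X.systemLaw f x, expNeg (∑' n, genSum f φ n C) *
      ∫⁻ K, expNeg (∫⁻ z, g z ∂K) ∂nextLaw X f s (t - s) C =
      expNeg (∑' n, genSum f (fun b w => φ b w + obs s u b w) n C) := by
    filter_upwards [ae_mem_multisets_growthFrag hH s x] with C hC
    simp only [genSum_add, ENNReal.tsum_add, expNeg_add]
    rw [← lintegral_growthFrag hu0, ← expNeg_logMean]
    conv_rhs => rw [(f.isLocallyFiniteMultiset hC).eq_ofSeq]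
    rw [← logMean_branchLaw hH hg]
    rfl
  simp only [hL]
  rw [lintegral_congr_ae hR, ← expNeg_logMean, ← expNeg_logMean,
    logMean_tsum_genSum hH (hφ.add (isCellFunctional_obs t hm h0)),
    logMean_tsum_genSum hH (hφ.add (isCellFunctional_obs s hu hu0)),
    cumulantLim_branching hφ hφs hst hm h0]

/-- With k fixed as a density, both sides are finite measures in B with the same Laplace functional,
hence equal. -/
theorem setLIntegral_preimage_growthFrag (hH : X.HypH f) {s t : ℝ≥0} (hst : s ≤ t) (x : ℝ≥0)
    {k : CellSystem → ℝ≥0∞} (hk : k ∈ historyClass f s) {B : Set (Measure ℝ≥0)}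
    (hB : MeasurableSet B) :
    ∫⁻ C in growthFrag f t ⁻¹' B, k C ∂X.systemLaw f x =
      ∫⁻ C, k C * nextLaw X f s (t - s) C B ∂X.systemLaw f x := by
  have hkm : Measurable k := (measurable_of_mem_historyClass hk).mono (history_le f s) le_rfl
  have hgt : Measurable (growthFrag f t) := measurable_growthFrag t
  have : IsFiniteMeasure ((X.systemLaw f x).withDensity k) := isFiniteMeasure_withDensity
    ((lintegral_mono (le_one_of_mem_historyClass hk)).trans_lt (by simp)).ne
  have hlaw : ((X.systemLaw f x).withDensity k).map (growthFrag f t) =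
      ((X.systemLaw f x).withDensity k).bind (nextLaw X f s (t - s)) := by
    refine ext_of_laplace fun g hg => ?_
    have hE : Measurable fun K : Measure ℝ≥0 => expNeg (∫⁻ z, g z ∂K) :=
      measurable_expNeg.comp (measurable_lintegral_measure hg)
    have hEt : Measurable fun C => expNeg (∫⁻ z, g z ∂growthFrag f t C) := hE.comp hgt
    rw [lintegral_map hE hgt, Measure.lintegral_bind (Kernel.aemeasurable _) hE.aemeasurable,
      lintegral_withDensity_eq_lintegral_mul _ hkm hEt,
      lintegral_withDensity_eq_lintegral_mul _ hkm hE.lintegral_kernel]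
    exact lintegral_mul_expNeg_growthFrag hH hst x hk hg
  have h := congrArg (fun μ => μ B) hlaw
  rw [Measure.map_apply hgt hB, Measure.bind_apply hB (Kernel.aemeasurable _),
    withDensity_apply _ (hgt hB),
    lintegral_withDensity_eq_lintegral_mul _ hkm (Kernel.measurable_coe _ hB)] at h
  exact h

/-- Now B is fixed and both sides are finite measures in D, compared on the history alone; they
agree on the multiplicative class that generates it. -/
theorem measure_inter_preimage_growthFrag (hH : X.HypH f) {s t : ℝ≥0} (hst : s ≤ t) (x : ℝ≥0)
    {B : Set (Measure ℝ≥0)} (hB : MeasurableSet B) {D : Set CellSystem}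
    (hD : MeasurableSet[history f s] D) :
    X.systemLaw f x (D ∩ growthFrag f t ⁻¹' B) =
      ∫⁻ C in D, nextLaw X f s (t - s) C B ∂X.systemLaw f x := by
  have hle := history_le f s
  have hN : Measurable fun C => nextLaw X f s (t - s) C B := Kernel.measurable_coe _ hB
  have : IsFiniteMeasure ((X.systemLaw f x).withDensity fun C => nextLaw X f s (t - s) C B) :=
    isFiniteMeasure_withDensity
      ((lintegral_mono fun C => prob_le_one).trans_lt (by simp)).ne
  have heq : ((X.systemLaw f x).restrict (growthFrag f t ⁻¹' B)).trim hle =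
      ((X.systemLaw f x).withDensity fun C => nextLaw X f s (t - s) C B).trim hle := by
    refine ext_of_mul_closed (m := history f s) (𝒦 := historyClass f s)
      (fun k hk => le_one_of_mem_historyClass hk) (one_mem_historyClass f s)
      (fun k hk l hl => mul_mem_historyClass hk hl)
      (fun k hk => measurable_of_mem_historyClass hk) (history_le_iSup_historyClass f s)
      fun k hk => ?_
    have hkm := measurable_of_mem_historyClass hk
    rw [lintegral_trim hle hkm, lintegral_trim hle hkm,
      setLIntegral_preimage_growthFrag hH hst x hk hB,
      lintegral_withDensity_eq_lintegral_mul _ hN (hkm.mono hle le_rfl)]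
    exact lintegral_congr fun C => mul_comm _ _
  have h := congrArg (fun μ => μ D) heq
  rw [trim_measurableSet_eq hle hD, trim_measurableSet_eq hle hD,
    Measure.restrict_apply (hle D hD), withDensity_apply _ (hle D hD)] at h
  exact h

theorem condExp_growthFrag (hH : X.HypH f) {s t : ℝ≥0} (hst : s ≤ t) (x : ℝ≥0)
    {B : Set (Measure ℝ≥0)} (hB : MeasurableSet B) :
    (X.systemLaw f x)⟦growthFrag f t ⁻¹' B | history f s⟧ =ᵐ[X.systemLaw f x]
      fun C => (X.rho f s t (growthFrag f s C)).real B := by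
  have hle := history_le f s
  have hB' : MeasurableSet (growthFrag f t ⁻¹' B) := measurable_growthFrag t hB
  have hN : Measurable[history f s] fun C => (nextLaw X f s (t - s) C).real B :=
    (measurable_nextLaw_apply s (t - s) hB).ennreal_toReal
  have hint : Integrable (fun C => (nextLaw X f s (t - s) C).real B) (X.systemLaw f x) :=
    Integrable.of_bound (hN.mono hle le_rfl).aestronglyMeasurable 1 (.of_forall fun C => by
      rw [Real.norm_of_nonneg measureReal_nonneg]
      exact measureReal_le_one)
  have hmain := ae_eq_condExp_of_forall_setIntegral_eq (μ := X.systemLaw f x) (m := history f s)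
    hle (f := (growthFrag f t ⁻¹' B).indicator fun _ => (1 : ℝ))
    (g := fun C => (nextLaw X f s (t - s) C).real B)
    ((integrable_const _).indicator hB') (fun D _ _ => hint.integrableOn) (fun D hD _ => ?_)
    hN.stronglyMeasurable.aestronglyMeasurable
  -- The version through the ranked points is measurable for the history; ρ, defined by a choice,
  -- coincides with it almost surely, and this is enough.
  · refine hmain.symm.trans ?_
    filter_upwards [ae_rho_eq_nextLaw hH s t x] with C hC
    rw [hC]
  · rw [setIntegral_indicator hB', setIntegral_const, smul_eq_mul, mul_one, measureReal_def,
      measure_inter_preimage_growthFrag hH hst x hB hD]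
    exact integral_toReal (Kernel.measurable_coe _ hB).aemeasurable
      (.of_forall fun C => measure_lt_top _ _)

end ConditionalLaw

end GrowthFrag

theorem mainTheorem9 (X : GrowthFrag.CellProc) (f : GrowthFrag.Gauge) (hH : X.HypH f)
    (s t : ℝ≥0) (hst : s ≤ t) :
    -- `ρ_{s,t}` is a well-defined probability kernel
    ((∀ y : ℕ → ℝ≥0, GrowthFrag.ofSeq y ∈ f.multisets s →
        X.rho f s t (GrowthFrag.ofSeq y) = X.branchLaw f (t - s) y) ∧
      Measurable (fun J : f.multisets s => X.rho f s t (J : Measure ℝ≥0)) ∧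
      ∀ J ∈ f.multisets s, IsProbabilityMeasure (X.rho f s t J) ∧
        ∀ᵐ K ∂X.rho f s t J, K ∈ f.multisets t) ∧
    -- it is the conditional law of the growth-fragmentation
    ∀ x : ℝ≥0, 0 < x →
      (∀ᵐ C ∂X.systemLaw f x, GrowthFrag.growthFrag f s C ∈ f.multisets s) ∧
      (∀ r : ℝ≥0, Measurable (GrowthFrag.growthFrag f r)) ∧
      ∀ B : Set (Measure ℝ≥0), MeasurableSet B →
        (X.systemLaw f x)⟦GrowthFrag.growthFrag f t ⁻¹' B | GrowthFrag.history f s⟧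
          =ᵐ[X.systemLaw f x]
        fun C => (X.rho f s t (GrowthFrag.growthFrag f s C)).real B := by
  refine ⟨⟨fun y _ => GrowthFrag.rho_ofSeq hH s t y, ?_, fun J hJ => ?_⟩, fun x _ =>
    ⟨GrowthFrag.ae_mem_multisets_growthFrag hH s x, GrowthFrag.measurable_growthFrag,
      fun B hB => GrowthFrag.condExp_growthFrag hH hst x hB⟩⟩
  · have h : (fun J : f.multisets s => X.rho f s t (J : Measure ℝ≥0)) =
        fun J : f.multisets s => X.branchLaw f (t - s) (GrowthFrag.ranked (J : Measure ℝ≥0)) :=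
      funext fun J => GrowthFrag.rho_eq_branchLaw_ranked hH s t J.2
    rw [h]
    exact (GrowthFrag.measurable_branchLaw _).comp
      (GrowthFrag.measurable_ranked.comp measurable_subtype_coe)
  · obtain ⟨y, rfl⟩ := hJ.1
    rw [GrowthFrag.rho_ofSeq hH]
    exact ⟨GrowthFrag.isProbabilityMeasure_branchLaw _ y,
      GrowthFrag.ae_mem_multisets_branchLaw hH hst hJ⟩
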